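/- Let $\sigma_1,\dots,\sigma_{p-1}$ be the standard generators of the braid group on $p$ strands. For integers $p\ge 2$, $q\ge 1$, $2\le r\le p$ and $s\ne 0$, the twisted torus link $T(p,q,r,s)$ is obtained from the $(p,q)$-torus link by performing $s$ full twists on $r$ adjacent strands; that is, it is the closure of the $p$-strand braid \[ (\sigma_1\sigma_2\cdots\sigma_{p-1})^{q}(\sigma_1\sigma_2\cdots\sigma_{r-1})^{sr}\quad\text{if } s>0, \qquad (\sigma_1\sigma_2\cdots\sigma_{p-1})^{q}(\sigma_{r-1}^{-1}\sigma_{r-2}^{-1}\cdots\sigma_1^{-1})^{-sr}\quad\text{if } s<0 . \] (Exchanging the crossing convention for $\sigma_i$ and $\sigma_i^{-1}$ replaces the link by its mirror image and does not affect the statement below.) **Lemma.** For every integer $n\ge 1$, the twisted torus link $T(2n+2,2n,2n+1,-1)$ is the two-component unlink; that is, it is isotopic to the union of two disjoint round circles in a plane that bound disjoint discs in that plane. -/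

import Mathlib

open scoped ContDiff

noncomputable section

/-! ### Links in three-space, isotopy, and the unlink -/

/-- Euclidean three-space. -/
abbrev E3 := EuclideanSpace ℝ (Fin 3)

/-- `γ` is a smooth embedding of `c` disjoint circles in three-space. The circle is
`ℝ / 2πℤ`, so each component is given as a `2π`-periodic curve. -/
structure IsLinkEmbedding {c : ℕ} (γ : Fin c → ℝ → E3) : Prop where
  smooth : ∀ a, ContDiff ℝ ∞ (γ a)
  periodic : ∀ a, Function.Periodic (γ a) (2 * Real.pi)
  immersion : ∀ a θ, deriv (γ a) θ ≠ 0
  injective : ∀ a b θ φ, γ a θ = γ b φ → a = b ∧ ∃ n : ℤ, φ = θ + n * (2 * Real.pi)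

/-- The subset of three-space traced out by a family of curves. -/
def linkImage {c : ℕ} (γ : Fin c → ℝ → E3) : Set E3 := ⋃ a, Set.range (γ a)

/-- Two (unoriented) links, viewed as subsets of three-space, are isotopic if there is a smooth
one-parameter family of smooth embeddings of a disjoint union of circles, starting at a
parametrization of the first and ending at a parametrization of the second. -/
def LinkIsotopic (L L' : Set E3) : Prop :=
  ∃ (c : ℕ) (H : ℝ → Fin c → ℝ → E3),
    (∀ a, ContDiff ℝ ∞ (fun p : ℝ × ℝ => H p.1 a p.2)) ∧
    (∀ t ∈ Set.Icc (0 : ℝ) 1, IsLinkEmbedding (H t)) ∧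
    linkImage (H 0) = L ∧ linkImage (H 1) = L'

/-- Unit circles in the plane `z = 0` centred at `(3a, 0, 0)`, for `a = 0, …, c - 1`. -/
def standardUnlinkCurve (c : ℕ) (a : Fin c) (θ : ℝ) : E3 :=
  !₂[3 * (a : ℝ) + Real.cos θ, Real.sin θ, 0]

/-- `L` is the unlink with `c` components. -/
def IsUnlink (c : ℕ) (L : Set E3) : Prop :=
  LinkIsotopic L (linkImage (standardUnlinkCurve c))

/-! ### Braid words and their closures -/

/-- Words in the generators of the braid group on `m` strands and their inverses. The letter
`(i, true)` is `σ_{i+1}` and `(i, false)` is its inverse, for `0 ≤ i < m - 1`. -/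
abbrev BraidWord (m : ℕ) := List (Fin (m - 1) × Bool)

/-- The formal inverse of a braid word. -/
def BraidWord.inverse {m : ℕ} (w : BraidWord m) : BraidWord m :=
  (w.map fun l => (l.1, !l.2)).reverse

/-- The `k`-th power of a braid word. -/
def BraidWord.power {m : ℕ} (w : BraidWord m) (k : ℕ) : BraidWord m :=
  (List.replicate k w).flatten

/-- The position, at time `u ∈ [0, 1]`, of the strand that starts at `(k, 0)`, in the geometric
braid of one letter: for `σ^{±1}` exchanging the points `(i, 0)` and `(i + 1, 0)`, these two make
half a turn about their midpoint (clockwise for `σ`, counterclockwise for its inverse), and every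
other strand stays put. For `none` no strand moves. The reparametrization by
`Real.smoothTransition` makes consecutive letters fit together smoothly. -/
def strandPosition {m : ℕ} (l : Option (Fin (m - 1) × Bool)) (k : Fin m) (u : ℝ) : ℝ × ℝ :=
  match l with
  | none => ((k : ℝ), 0)
  | some (i, ε) =>
    let α : ℝ := Real.pi * Real.smoothTransition u
    let e : ℝ := if ε then 1 else -1
    if (k : ℕ) = i then ((i : ℝ) + 1 / 2 - Real.cos α / 2, e * (Real.sin α / 2))
    else if (k : ℕ) = i + 1 then ((i : ℝ) + 1 / 2 + Real.cos α / 2, -(e * (Real.sin α / 2)))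
    else ((k : ℝ), 0)

/-- The point of the half-plane at angle `θ` around the `z`-axis at distance `1 + x.1` from the
axis and height `x.2`. -/
def bookPoint (θ : ℝ) (x : ℝ × ℝ) : E3 :=
  !₂[(1 + x.1) * Real.cos θ, (1 + x.1) * Real.sin θ, x.2]

/-- The closure of a braid word `w` around the `z`-axis: the full turn is divided into
`w.length + 1` equal sectors; the letters of `w` are put in order in all but the last one, and in
the last one the strands are closed up by parallel arcs. -/
def braidClosure {m : ℕ} (w : BraidWord m) : Set E3 :=
  {P | ∃ j : ℕ, j ≤ w.length ∧ ∃ k : Fin m, ∃ u ∈ Set.Icc (0 : ℝ) 1,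
    P = bookPoint (2 * Real.pi * ((j + u) / (w.length + 1))) (strandPosition w[j]? k u)}

/-! ### Twisted torus links -/

/-- The braid word `σ_1 σ_2 ⋯ σ_{r-1}` on `m ≥ r` strands. -/
def ascendingWord (m r : ℕ) (hr : r ≤ m) : BraidWord m :=
  (List.finRange (r - 1)).map fun i => (Fin.castLE (Nat.sub_le_sub_right hr 1) i, true)

/-- `s` full twists on the first `r` of `m` strands: `(σ_1 ⋯ σ_{r-1})^{sr}` if `s ≥ 0` and
`(σ_{r-1}⁻¹ ⋯ σ_1⁻¹)^{-sr}` if `s < 0`. -/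
def fullTwistWord (m r : ℕ) (hr : r ≤ m) (s : ℤ) : BraidWord m :=
  if 0 ≤ s then (ascendingWord m r hr).power (s.natAbs * r)
  else (ascendingWord m r hr).inverse.power (s.natAbs * r)

/-- The braid word `(σ_1 ⋯ σ_{p-1})^q` of the torus link `T(p, q)` followed by `s` full twists on
the first `r ≤ p` strands. -/
def twistedTorusWord (p q r : ℕ) (hr : r ≤ p) (s : ℤ) : BraidWord p :=
  (ascendingWord p p le_rfl).power q ++ fullTwistWord p r hr s

/-- The twisted torus link `T(p, q, r, s)`, for `r ≤ p`. -/
def twistedTorusLink (p q r : ℕ) (hr : r ≤ p) (s : ℤ) : Set E3 :=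
  braidClosure (twistedTorusWord p q r hr s)

end

/-! Write A for the ascending product on the first 2n+1 strands, A' for the one on all 2n+2 strands,
and D for the descending run S(2n)⋯S(1), with generators numbered from 0. The braid relations give
A'^(2n) = A^(2n) D (`ascendingProd_pow`), so the link is the closure of A^(2n) D A^(-(2n+1)).
Conjugation and cancellation leave D A^(-1) (`wordLoop_append_conj`,
`wordClass_twistSuffix_append`): one strand passes below 2n others, then another passes above 2n
others.

In this reduced braid every strand can be kept in a layer of its own, with positive heights on one
cycle of the permutation and negative heights on the other (`wordLayered_spiralWord`). A layered
motion is determined up to homotopy by its heights and its permutation (`LayeredPath.homotopic`), so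
the two components move apart into an upper and a lower sheet. In its sheet each component winds n+1
times around the axis and deforms to a torus curve whose height has one maximum and one minimum
(`spiralBraid_homotopic_torusBraid`). Such a curve is unknotted: at each level it has two points,
and the chord between them can be straightened level by level (`levelCurve_isotopic_center`).

Braids are handled as paths in a configuration space, up to homotopy; the layering principle also
supplies the group relations (`WordLayered.wordClass_eq`). Only continuous homotopies of closed
braids have to be constructed, because `BraidHomotopic.paramIsotopic` smooths them into isotopies of
embedded circles. -/

noncomputable section

/-! ### Parametrized smooth isotopies -/

/-- Two parametrized links are isotopic through a smooth family of link embeddings. -/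
def ParamIsotopic {c : ℕ} (γ γ' : Fin c → ℝ → E3) : Prop :=
  ∃ H : ℝ → Fin c → ℝ → E3,
    (∀ a, ContDiff ℝ ∞ (fun p : ℝ × ℝ => H p.1 a p.2)) ∧
    (∀ t ∈ Set.Icc (0 : ℝ) 1, IsLinkEmbedding (H t)) ∧ H 0 = γ ∧ H 1 = γ'

theorem ParamIsotopic.linkIsotopic {c : ℕ} {γ γ' : Fin c → ℝ → E3} (h : ParamIsotopic γ γ') :
    LinkIsotopic (linkImage γ) (linkImage γ') := by
  obtain ⟨H, h1, h2, h3, h4⟩ := h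
  exact ⟨c, H, h1, h2, by rw [h3], by rw [h4]⟩

theorem ParamIsotopic.trans {c : ℕ} {γ γ' γ'' : Fin c → ℝ → E3} (h : ParamIsotopic γ γ')
    (h' : ParamIsotopic γ' γ'') : ParamIsotopic γ γ'' := by
  obtain ⟨H, h1, h2, h3, h4⟩ := h
  obtain ⟨K, k1, k2, k3, k4⟩ := h'
  have hs : ContDiff ℝ ∞ Real.smoothTransition := Real.smoothTransition.contDiff
  have s1 : ContDiff ℝ ∞ (fun p : ℝ × ℝ => Real.smoothTransition (2 * p.1)) :=
    hs.comp (contDiff_const.mul contDiff_fst)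
  have s2 : ContDiff ℝ ∞ (fun p : ℝ × ℝ => Real.smoothTransition (2 * p.1 - 1)) :=
    hs.comp ((contDiff_const.mul contDiff_fst).sub contDiff_const)
  -- At every time at least one of the two isotopies rests at `γ'`, so subtracting `γ'` leaves the
  -- moving one. A single formula avoids gluing smooth functions at t = 1/2.
  refine ⟨fun t a θ => H (Real.smoothTransition (2 * t)) a θ +
    K (Real.smoothTransition (2 * t - 1)) a θ - γ' a θ, fun a => ?_, fun t ht => ?_, ?_, ?_⟩
  · have g : ContDiff ℝ ∞ (fun p : ℝ × ℝ => γ' a p.2) := by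
      rw [← h4]
      exact (h1 a).comp (contDiff_const.prodMk contDiff_snd)
    exact (((h1 a).comp (s1.prodMk contDiff_snd)).add
      ((k1 a).comp (s2.prodMk contDiff_snd))).sub g
  · rcases le_total t (1 / 2) with h | h
    · have e : Real.smoothTransition (2 * t - 1) = 0 :=
        Real.smoothTransition.zero_of_nonpos (by linarith)
      simp only [e, k3, add_sub_cancel_right]
      exact h2 _ ⟨Real.smoothTransition.nonneg _, Real.smoothTransition.le_one _⟩
    · have e : Real.smoothTransition (2 * t) = 1 :=
        Real.smoothTransition.one_of_one_le (by linarith)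
      simp only [e, h4, add_sub_cancel_left]
      exact k2 _ ⟨Real.smoothTransition.nonneg _, Real.smoothTransition.le_one _⟩
  · have e : Real.smoothTransition (2 * 0) = 0 :=
      Real.smoothTransition.zero_of_nonpos (by simp)
    have e' : Real.smoothTransition (2 * 0 - 1) = 0 :=
      Real.smoothTransition.zero_of_nonpos (by norm_num)
    funext a θ
    simp only [e, e', h3, k3, add_sub_cancel_right]
  · have e : Real.smoothTransition (2 * 1) = 1 :=
      Real.smoothTransition.one_of_one_le (by norm_num)
    have e' : Real.smoothTransition (2 * 1 - 1) = 1 :=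
      Real.smoothTransition.one_of_one_le (by norm_num)
    funext a θ
    simp only [e, e', h4, k4, add_sub_cancel_left]

/-! ### Smooth curves in coordinates -/

theorem contDiff_e3 {E : Type*} [NormedAddCommGroup E] [NormedSpace ℝ E] {f g h : E → ℝ}
    (hf : ContDiff ℝ ∞ f) (hg : ContDiff ℝ ∞ g) (hh : ContDiff ℝ ∞ h) :
    ContDiff ℝ ∞ (fun x => (!₂[f x, g x, h x] : E3)) := by
  rw [contDiff_euclidean]
  intro i
  fin_cases i
  · simpa using hf
  · simpa using hg
  · simpa using hh

theorem e3_eq_iff {a b c a' b' c' : ℝ} :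
    (!₂[a, b, c] : E3) = !₂[a', b', c'] ↔ a = a' ∧ b = b' ∧ c = c' := by
  constructor
  · intro h
    have h0 := congrArg (fun v : E3 => v 0) h
    have h1 := congrArg (fun v : E3 => v 1) h
    have h2 := congrArg (fun v : E3 => v 2) h
    simp at h0 h1 h2
    exact ⟨h0, h1, h2⟩
  · rintro ⟨rfl, rfl, rfl⟩
    rfl

theorem hasDerivAt_e3 {f g h : ℝ → ℝ} {f' g' h' x : ℝ}
    (hf : HasDerivAt f f' x) (hg : HasDerivAt g g' x) (hh : HasDerivAt h h' x) :
    HasDerivAt (fun x => (!₂[f x, g x, h x] : E3)) !₂[f', g', h'] x := by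
  have hp : HasDerivAt (fun x => ![f x, g x, h x]) ![f', g', h'] x := by
    rw [hasDerivAt_pi]
    intro i
    fin_cases i
    · simpa using hf
    · simpa using hg
    · simpa using hh
  exact ((EuclideanSpace.equiv (Fin 3) ℝ).symm : (Fin 3 → ℝ) →L[ℝ] E3).hasFDerivAt.comp_hasDerivAt
    x hp

theorem deriv_e3_ne_zero {f g h : ℝ → ℝ} {f' g' h' x : ℝ}
    (hf : HasDerivAt f f' x) (hg : HasDerivAt g g' x) (hh : HasDerivAt h h' x)
    (h0 : ¬ (f' = 0 ∧ g' = 0 ∧ h' = 0)) :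
    deriv (fun x => (!₂[f x, g x, h x] : E3)) x ≠ 0 := by
  rw [(hasDerivAt_e3 hf hg hh).deriv]
  intro h1
  apply h0
  have : (0 : E3) = !₂[0, 0, 0] := by
    ext i; fin_cases i <;> simp
  rw [this] at h1
  exact e3_eq_iff.1 h1

theorem exists_int_of_cos_sin_eq {θ φ : ℝ} (hc : Real.cos θ = Real.cos φ)
    (hs : Real.sin θ = Real.sin φ) : ∃ n : ℤ, φ = θ + n * (2 * Real.pi) := by
  have h : (φ : Real.Angle) = θ := Real.Angle.cos_sin_inj hc.symm hs.symm
  obtain ⟨n, hn⟩ := Real.Angle.angle_eq_iff_two_pi_dvd_sub.1 h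
  exact ⟨n, by linarith⟩

/-! ### Unknotting curves with one maximum and one minimum -/

/-- A smooth family of curves at heights `ε_a (5 + cos θ)` in which the two points of each
component at the same height differ by `2 sin θ • (u, v)` with `(u, v) ≠ 0`. -/
def levelCurve (ε : Fin 2 → ℝ) (e₁ e₂ : ℝ → ℝ) (u v : ℝ → ℝ) (a : Fin 2) (θ : ℝ) : E3 :=
  !₂[e₁ θ + Real.sin θ * u (Real.cos θ), e₂ θ + Real.sin θ * v (Real.cos θ),
    ε a * (5 + Real.cos θ)]

theorem sign_cases {ε : Fin 2 → ℝ} (h0 : ε 0 = 1) (h1 : ε 1 = -1) {a b : Fin 2} {x y : ℝ}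
    (hx : 0 < x) (hy : 0 < y) (h : ε a * x = ε b * y) : a = b ∧ x = y := by
  fin_cases a <;> fin_cases b <;> simp_all <;> linarith

/-- The height determines the component and cos θ, so only the parameters θ and -θ can collide. The
even centre cancels there and leaves sin θ • (u, v) = 0, hence sin θ = 0 and the parameters agree
modulo 2π. For the immersion, the height has nonzero derivative when sin θ ≠ 0; when sin θ = 0 the
centre is stationary and the horizontal velocity is cos θ • (u, v). -/
theorem levelCurve_isLinkEmbedding {ε : Fin 2 → ℝ} (h0 : ε 0 = 1) (h1 : ε 1 = -1)
    {e₁ e₂ u v : ℝ → ℝ} (he₁ : ContDiff ℝ ∞ e₁) (he₂ : ContDiff ℝ ∞ e₂)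
    (hu : ContDiff ℝ ∞ u) (hv : ContDiff ℝ ∞ v)
    (pe₁ : Function.Periodic e₁ (2 * Real.pi)) (pe₂ : Function.Periodic e₂ (2 * Real.pi))
    (ee₁ : ∀ θ, e₁ (-θ) = e₁ θ) (ee₂ : ∀ θ, e₂ (-θ) = e₂ θ)
    (huv : ∀ x ∈ Set.Icc (-1 : ℝ) 1, ¬ (u x = 0 ∧ v x = 0)) :
    IsLinkEmbedding (levelCurve ε e₁ e₂ u v) := by
  have hε : ∀ a, ε a ≠ 0 := by
    intro a; fin_cases a <;> simp [h0, h1]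
  have hcos : ∀ θ, Real.cos θ ∈ Set.Icc (-1 : ℝ) 1 :=
    fun θ => ⟨Real.neg_one_le_cos θ, Real.cos_le_one θ⟩
  have even_deriv : ∀ e : ℝ → ℝ, ContDiff ℝ ∞ e → Function.Periodic e (2 * Real.pi) →
      (∀ θ, e (-θ) = e θ) → ∀ θ, Real.sin θ = 0 → HasDerivAt e 0 θ := by
    intro e he pe ee θ hθ
    obtain ⟨n, rfl⟩ := Real.sin_eq_zero_iff.1 hθ
    have hd : HasDerivAt e (deriv e (n * Real.pi)) (n * Real.pi) :=
      (he.differentiable (by simp)).differentiableAt.hasDerivAt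
    -- An even function of period 2π is symmetric about every multiple of π, so its derivative there
    -- equals its own negative.
    have hfun : (fun x => e (2 * (n * Real.pi) - x)) = e := by
      funext x
      have : 2 * (n * Real.pi) - x = -(x - n * (2 * Real.pi)) := by ring
      rw [this, ee, pe.sub_int_mul_eq]
    have h2 : HasDerivAt (fun x => e (2 * (n * Real.pi) - x)) (-deriv e (n * Real.pi))
        (n * Real.pi) := by
      have : HasDerivAt e (deriv e (n * Real.pi)) (2 * (n * Real.pi) - n * Real.pi) := by
        convert hd using 1; ring
      simpa using this.comp_const_sub (2 * (n * Real.pi)) (n * Real.pi)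
    rw [hfun] at h2
    have := hd.unique h2
    have h3 : deriv e (n * Real.pi) = 0 := by linarith
    rwa [h3] at hd
  refine ⟨fun a => ?_, fun a θ => ?_, fun a θ => ?_, fun a b θ φ h => ?_⟩
  · exact contDiff_e3 (he₁.add (Real.contDiff_sin.mul (hu.comp Real.contDiff_cos)))
      (he₂.add (Real.contDiff_sin.mul (hv.comp Real.contDiff_cos)))
      (contDiff_const.mul (contDiff_const.add Real.contDiff_cos))
  · simp only [levelCurve, pe₁ θ, pe₂ θ, Real.sin_add_two_pi, Real.cos_add_two_pi]
  · by_cases hs : Real.sin θ = 0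
    · have hu' := ((hu.differentiable (by simp)).differentiableAt (x := Real.cos θ)).hasDerivAt
      have hv' := ((hv.differentiable (by simp)).differentiableAt (x := Real.cos θ)).hasDerivAt
      have hcu := (Real.hasDerivAt_sin θ).mul (hu'.comp θ (Real.hasDerivAt_cos θ))
      have hcv := (Real.hasDerivAt_sin θ).mul (hv'.comp θ (Real.hasDerivAt_cos θ))
      have hc0 : Real.cos θ ≠ 0 := by
        intro h; have := Real.sin_sq_add_cos_sq θ; simp [h, hs] at this
      refine deriv_e3_ne_zero ((even_deriv e₁ he₁ pe₁ ee₁ θ hs).add hcu)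
        ((even_deriv e₂ he₂ pe₂ ee₂ θ hs).add hcv)
        (((Real.hasDerivAt_cos θ).const_add 5).const_mul (ε a)) ?_
      rintro ⟨k1, k2, -⟩
      simp [hs, hc0] at k1 k2
      exact huv _ (hcos θ) ⟨k1, k2⟩
    · have hd : ∀ f : ℝ → ℝ, ContDiff ℝ ∞ f → HasDerivAt f (deriv f θ) θ :=
        fun f hf => (hf.differentiable (by simp)).differentiableAt.hasDerivAt
      refine deriv_e3_ne_zero
        (hd _ (he₁.add (Real.contDiff_sin.mul (hu.comp Real.contDiff_cos))))
        (hd _ (he₂.add (Real.contDiff_sin.mul (hv.comp Real.contDiff_cos))))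
        (((Real.hasDerivAt_cos θ).const_add 5).const_mul (ε a)) ?_
      rintro ⟨-, -, k⟩
      simp [hs, hε] at k
  · obtain ⟨k1, k2, k3⟩ := e3_eq_iff.1 h
    have p1 := hcos θ
    have p2 := hcos φ
    obtain ⟨hab, hc⟩ := sign_cases h0 h1 (by linarith [p1.1]) (by linarith [p2.1]) k3
    have hc : Real.cos θ = Real.cos φ := by linarith
    refine ⟨hab, ?_⟩
    obtain ⟨n, hn⟩ := Real.cos_eq_cos_iff.1 hc
    rcases hn with hn | hn
    · exact ⟨n, by rw [hn]; ring⟩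
    · apply exists_int_of_cos_sin_eq hc
      have hsφ : Real.sin φ = - Real.sin θ := by
        have : φ = n * (2 * Real.pi) - θ := by rw [hn]; ring
        rw [this, Real.sin_int_mul_two_pi_sub]
      have hh : ∀ e : ℝ → ℝ, Function.Periodic e (2 * Real.pi) → (∀ θ, e (-θ) = e θ) →
          e φ = e θ := by
        intro e pe ee
        have : φ = -(θ - n * (2 * Real.pi)) := by rw [hn]; ring
        rw [this, ee, pe.sub_int_mul_eq]
      rw [hh e₁ pe₁ ee₁, hsφ, ← hc] at k1
      rw [hh e₂ pe₂ ee₂, hsφ, ← hc] at k2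
      have k1' : Real.sin θ * u (Real.cos θ) = 0 := by linarith
      have k2' : Real.sin θ * v (Real.cos θ) = 0 := by linarith
      have : Real.sin θ = 0 := by
        by_contra hne
        exact huv _ p1 ⟨(mul_eq_zero.1 k1').resolve_left hne,
          (mul_eq_zero.1 k2').resolve_left hne⟩
      rw [hsφ, this, neg_zero]

/-- The two sheets of heights of the two components. -/
def sheetSign (a : Fin 2) : ℝ := if a = 0 then 1 else -1

theorem sheetSign_zero : sheetSign 0 = 1 := rfl
theorem sheetSign_one : sheetSign 1 = -1 := rfl

/-- Two `(q, 1)` torus curves, one above the plane `z = 0` and one below. -/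
def torusCurve (q : ℕ) (a : Fin 2) (θ : ℝ) : E3 :=
  !₂[(2 - Real.sin θ) * Real.cos (q * θ), (2 - Real.sin θ) * Real.sin (q * θ),
    sheetSign a * (5 + Real.cos θ)]

open Polynomial.Chebyshev in
-- Since cos qθ = T_q(cos θ) and sin qθ = sin θ · U_{q-1}(cos θ), each horizontal coordinate splits
-- into an even part and sin θ times a polynomial in cos θ.
theorem torusCurve_eq_levelCurve (q : ℕ) : torusCurve q = levelCurve sheetSign
    (fun θ => 2 * Real.cos (q * θ)) (fun θ => -(Real.sin θ * Real.sin (q * θ)))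
    (fun x => -(T ℝ q).eval x) (fun x => 2 * (U ℝ ((q : ℤ) - 1)).eval x) := by
  funext a θ
  have h1 := T_real_cos θ q
  have h2 := U_real_cos θ ((q : ℤ) - 1)
  push_cast at h1 h2
  rw [sub_add_cancel] at h2
  simp only [torusCurve, levelCurve, e3_eq_iff, and_true]
  constructor
  · rw [h1]; ring
  · rw [← h2]; ring

open Polynomial.Chebyshev in
-- At x = cos θ a common root would make cos qθ and sin qθ vanish together.
theorem chebyshev_no_common_root (q : ℕ) (x : ℝ) (hx : x ∈ Set.Icc (-1 : ℝ) 1) :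
    ¬ (-(T ℝ q).eval x = 0 ∧ 2 * (U ℝ ((q : ℤ) - 1)).eval x = 0) := by
  rintro ⟨h1, h2⟩
  obtain ⟨θ, rfl⟩ : ∃ θ, Real.cos θ = x := ⟨Real.arccos x, Real.cos_arccos hx.1 hx.2⟩
  have k1 := T_real_cos θ q
  have k2 := U_real_cos θ ((q : ℤ) - 1)
  push_cast at k1 k2
  rw [sub_add_cancel] at k2
  have h2 : (U ℝ ((q : ℤ) - 1)).eval (Real.cos θ) = 0 := by linarith
  rw [h2, zero_mul] at k2
  have h1 : (T ℝ q).eval (Real.cos θ) = 0 := by linarith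
  rw [h1] at k1
  have := Real.sin_sq_add_cos_sq (q * θ)
  rw [← k1, ← k2] at this
  norm_num at this

theorem levelCurve_family_contDiff {ε : Fin 2 → ℝ} {f₁ f₂ g₁ g₂ : ℝ × ℝ → ℝ}
    (hf₁ : ContDiff ℝ ∞ f₁) (hf₂ : ContDiff ℝ ∞ f₂) (hg₁ : ContDiff ℝ ∞ g₁)
    (hg₂ : ContDiff ℝ ∞ g₂) (a : Fin 2) :
    ContDiff ℝ ∞ (fun p : ℝ × ℝ => levelCurve ε (fun θ => f₁ (p.1, θ)) (fun θ => f₂ (p.1, θ))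
      (fun x => g₁ (p.1, x)) (fun x => g₂ (p.1, x)) a p.2) := by
  have hp : ContDiff ℝ ∞ (fun p : ℝ × ℝ => (p.1, Real.cos p.2)) :=
    contDiff_fst.prodMk (Real.contDiff_cos.comp contDiff_snd)
  have hs : ContDiff ℝ ∞ (fun p : ℝ × ℝ => Real.sin p.2) := Real.contDiff_sin.comp contDiff_snd
  have hc : ContDiff ℝ ∞ (fun p : ℝ × ℝ => Real.cos p.2) := Real.contDiff_cos.comp contDiff_snd
  exact contDiff_e3 (hf₁.add (hs.mul (hg₁.comp hp))) (hf₂.add (hs.mul (hg₂.comp hp)))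
    (contDiff_const.mul (contDiff_const.add hc))

/-- The centres shrink to 0 while the chord direction at level x is replaced by the one at level (1
- t)x + t. This level stays in [-1, 1], so the direction never vanishes, and at t = 1 it is the
direction at the top. -/
theorem levelCurve_isotopic_center {e₁ e₂ u v : ℝ → ℝ} (he₁ : ContDiff ℝ ∞ e₁)
    (he₂ : ContDiff ℝ ∞ e₂) (hu : ContDiff ℝ ∞ u) (hv : ContDiff ℝ ∞ v)
    (pe₁ : Function.Periodic e₁ (2 * Real.pi)) (pe₂ : Function.Periodic e₂ (2 * Real.pi))
    (ee₁ : ∀ θ, e₁ (-θ) = e₁ θ) (ee₂ : ∀ θ, e₂ (-θ) = e₂ θ)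
    (huv : ∀ x ∈ Set.Icc (-1 : ℝ) 1, ¬ (u x = 0 ∧ v x = 0)) :
    ParamIsotopic (levelCurve sheetSign e₁ e₂ u v)
      (levelCurve sheetSign (fun _ => 0) (fun _ => 0) (fun _ => u 1) (fun _ => v 1)) := by
  have h1 : ContDiff ℝ ∞ (fun p : ℝ × ℝ => 1 - p.1) := contDiff_const.sub contDiff_fst
  have hx : ContDiff ℝ ∞ (fun p : ℝ × ℝ => (1 - p.1) * p.2 + p.1) :=
    (h1.mul contDiff_snd).add contDiff_fst
  refine ⟨fun t => levelCurve sheetSign (fun θ => (1 - t) * e₁ θ) (fun θ => (1 - t) * e₂ θ)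
    (fun x => u ((1 - t) * x + t)) (fun x => v ((1 - t) * x + t)), fun a =>
    levelCurve_family_contDiff (f₁ := fun p => (1 - p.1) * e₁ p.2)
      (f₂ := fun p => (1 - p.1) * e₂ p.2) (g₁ := fun p => u ((1 - p.1) * p.2 + p.1))
      (g₂ := fun p => v ((1 - p.1) * p.2 + p.1))
      (h1.mul (he₁.comp contDiff_snd)) (h1.mul (he₂.comp contDiff_snd))
      (hu.comp hx) (hv.comp hx) a, fun t ht => ?_, by simp, by simp⟩
  have hxt : ContDiff ℝ ∞ (fun x : ℝ => (1 - t) * x + t) :=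
    (contDiff_const.mul contDiff_id).add contDiff_const
  refine levelCurve_isLinkEmbedding sheetSign_zero sheetSign_one (contDiff_const.mul he₁)
    (contDiff_const.mul he₂) (hu.comp hxt) (hv.comp hxt) (fun θ => by simp [pe₁ θ])
    (fun θ => by simp [pe₂ θ]) (fun θ => by simp [ee₁ θ]) (fun θ => by simp [ee₂ θ]) ?_
  intro x hx'
  refine huv _ ⟨?_, ?_⟩
  · nlinarith [ht.1, ht.2, hx'.1, hx'.2]
  · nlinarith [ht.1, ht.2, hx'.1, hx'.2]

open Polynomial.Chebyshev in
theorem torusCurve_isotopic_standardUnlink (q : ℕ) :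
    ParamIsotopic (torusCurve q) (standardUnlinkCurve 2) := by
  have hsq : ContDiff ℝ ∞ (fun θ : ℝ => Real.sin (q * θ)) :=
    Real.contDiff_sin.comp (contDiff_const.mul contDiff_id)
  have hcq : ContDiff ℝ ∞ (fun θ : ℝ => Real.cos (q * θ)) :=
    Real.contDiff_cos.comp (contDiff_const.mul contDiff_id)
  have aux : ∀ θ : ℝ, (q : ℝ) * (θ + 2 * Real.pi) = q * θ + q * (2 * Real.pi) :=
    fun θ => by ring
  -- The constants are the values at x = 1: -T_q(1) = -1 and 2 U_{q-1}(1) = 2q.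
  have s1 : ParamIsotopic (torusCurve q) (levelCurve sheetSign (fun _ => 0) (fun _ => 0)
      (fun _ => -1) (fun _ => 2 * q)) := by
    have := levelCurve_isotopic_center (e₁ := fun θ => 2 * Real.cos (q * θ))
      (e₂ := fun θ => -(Real.sin θ * Real.sin (q * θ)))
      (u := fun x => -(T ℝ q).eval x) (v := fun x => 2 * (U ℝ ((q : ℤ) - 1)).eval x)
      (contDiff_const.mul hcq) (Real.contDiff_sin.mul hsq).neg
      (by simpa using (Polynomial.contDiff_aeval (𝕜 := ℝ) (T ℝ q) ∞).neg)
      (contDiff_const.mul (by simpa using Polynomial.contDiff_aeval (𝕜 := ℝ) (U ℝ ((q : ℤ) - 1)) ∞))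
      (fun θ => by
        show 2 * Real.cos (q * (θ + 2 * Real.pi)) = 2 * Real.cos (q * θ)
        rw [aux, Real.cos_add_nat_mul_two_pi])
      (fun θ => by
        show -(Real.sin (θ + 2 * Real.pi) * Real.sin (q * (θ + 2 * Real.pi))) =
          -(Real.sin θ * Real.sin (q * θ))
        rw [aux, Real.sin_add_nat_mul_two_pi, Real.sin_add_two_pi])
      (fun θ => by simp) (fun θ => by simp) (chebyshev_no_common_root q)
    rw [← torusCurve_eq_levelCurve] at this
    simpa using this
  -- The segment from (-1, 2q) to (0, 1) misses the origin: its first coordinate vanishes only at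
  -- the end, where the second is 1.
  have s2 : ParamIsotopic (levelCurve sheetSign (fun _ => 0) (fun _ => 0)
      (fun _ => -1) (fun _ => 2 * q))
      (levelCurve sheetSign (fun _ => 0) (fun _ => 0) (fun _ => 0) (fun _ => 1)) := by
    refine ⟨fun t => levelCurve sheetSign (fun _ => 0) (fun _ => 0) (fun _ => -(1 - t))
      (fun _ => (1 - t) * (2 * q) + t), fun a =>
      levelCurve_family_contDiff (f₁ := fun p => 0) (f₂ := fun p => 0)
        (g₁ := fun p => -(1 - p.1)) (g₂ := fun p => (1 - p.1) * (2 * q) + p.1)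
        contDiff_const contDiff_const (contDiff_const.sub contDiff_fst).neg
        (((contDiff_const.sub contDiff_fst).mul contDiff_const).add contDiff_fst) a,
      fun t ht => ?_, by simp, by simp⟩
    refine levelCurve_isLinkEmbedding sheetSign_zero sheetSign_one contDiff_const contDiff_const
      contDiff_const contDiff_const (fun _ => rfl) (fun _ => rfl) (fun _ => rfl) (fun _ => rfl) ?_
    rintro x - ⟨h1, h2⟩
    have : t = 1 := by linarith
    subst this
    norm_num at h2
  -- Each vertical circle is rotated by a right angle about a horizontal axis through its centre.
  -- The heights stay within 1 of ±5, so the components remain apart.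
  have s3 : ParamIsotopic (levelCurve sheetSign (fun _ => 0) (fun _ => 0) (fun _ => 0)
      (fun _ => 1)) (fun a θ => !₂[Real.cos θ, Real.sin θ, sheetSign a * 5]) := by
    have hh : ContDiff ℝ ∞ (fun p : ℝ × ℝ => Real.pi / 2 * p.1) := contDiff_const.mul contDiff_fst
    refine ⟨fun t a θ => !₂[Real.sin (Real.pi / 2 * t) * Real.cos θ, Real.sin θ,
      sheetSign a * (5 + Real.cos (Real.pi / 2 * t) * Real.cos θ)], fun a => ?_, fun t ht => ?_,
      ?_, ?_⟩
    · exact contDiff_e3 ((Real.contDiff_sin.comp hh).mul (Real.contDiff_cos.comp contDiff_snd))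
        (Real.contDiff_sin.comp contDiff_snd) (contDiff_const.mul (contDiff_const.add
        ((Real.contDiff_cos.comp hh).mul (Real.contDiff_cos.comp contDiff_snd))))
    · have h1 := Real.sin_sq_add_cos_sq (Real.pi / 2 * t)
      have hne : ∀ x, Real.sin (Real.pi / 2 * t) * x = 0 →
          Real.cos (Real.pi / 2 * t) * x = 0 → x = 0 := by
        intro x hx hy
        have : (Real.sin (Real.pi / 2 * t) ^ 2 + Real.cos (Real.pi / 2 * t) ^ 2) * x = 0 := by
          linear_combination Real.sin (Real.pi / 2 * t) * hx + Real.cos (Real.pi / 2 * t) * hy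
        rwa [h1, one_mul] at this
      refine ⟨fun a => ?_, fun a θ => ?_, fun a θ => ?_, fun a b θ φ h => ?_⟩
      · exact contDiff_e3 (contDiff_const.mul Real.contDiff_cos) Real.contDiff_sin
          (contDiff_const.mul (contDiff_const.add (contDiff_const.mul Real.contDiff_cos)))
      · simp only [Real.sin_add_two_pi, Real.cos_add_two_pi]
      · refine deriv_e3_ne_zero ((Real.hasDerivAt_cos θ).const_mul _) (Real.hasDerivAt_sin θ)
          ((((Real.hasDerivAt_cos θ).const_mul _).const_add 5).const_mul _) ?_
        rintro ⟨k1, k2, k3⟩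
        have hεa : sheetSign a ≠ 0 := by unfold sheetSign; split_ifs <;> norm_num
        have k3 := (mul_eq_zero.1 k3).resolve_left hεa
        have := hne _ k1 k3
        have h2 := Real.sin_sq_add_cos_sq θ
        rw [k2, neg_eq_zero.1 this] at h2
        norm_num at h2
      · obtain ⟨k1, k2, k3⟩ := e3_eq_iff.1 h
        have b1 : ∀ x, |Real.cos (Real.pi / 2 * t) * Real.cos x| ≤ 1 := fun x => by
          rw [abs_mul]
          exact mul_le_one₀ (Real.abs_cos_le_one _) (abs_nonneg _) (Real.abs_cos_le_one _)
        obtain ⟨hab, hc⟩ := sign_cases sheetSign_zero sheetSign_one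
          (by linarith [(abs_le.1 (b1 θ)).1]) (by linarith [(abs_le.1 (b1 φ)).1]) k3
        refine ⟨hab, exists_int_of_cos_sin_eq ?_ k2⟩
        exact sub_eq_zero.1 (hne _ (by linarith) (by linarith))
    · funext a θ
      simp [levelCurve]
    · funext a θ
      simp
  -- The two horizontal circles slide apart while descending to one plane. Height separates them
  -- before t = 1; at t = 1 their centres are 3 apart and their radii are 1.
  have s4 : ParamIsotopic (fun a θ => !₂[Real.cos θ, Real.sin θ, sheetSign a * 5])
      (standardUnlinkCurve 2) := by
    refine ⟨fun t a θ => !₂[t * (3 * ((a : ℕ) : ℝ)) + Real.cos θ, Real.sin θ,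
      sheetSign a * (5 * (1 - t))],
      fun a => ?_, fun t ht => ⟨fun a => ?_, fun a θ => ?_, fun a θ => ?_, fun a b θ φ h => ?_⟩,
      ?_, ?_⟩
    · exact contDiff_e3 ((contDiff_fst.mul contDiff_const).add
        (Real.contDiff_cos.comp contDiff_snd))
        (Real.contDiff_sin.comp contDiff_snd) (contDiff_const.mul (contDiff_const.mul
        (contDiff_const.sub contDiff_fst)))
    · exact contDiff_e3 (contDiff_const.add Real.contDiff_cos) Real.contDiff_sin contDiff_const
    · simp only [Real.sin_add_two_pi, Real.cos_add_two_pi]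
    · refine deriv_e3_ne_zero ((Real.hasDerivAt_cos θ).const_add _) (Real.hasDerivAt_sin θ)
        (hasDerivAt_const θ _) ?_
      rintro ⟨k1, k2, -⟩
      have h2 := Real.sin_sq_add_cos_sq θ
      rw [k2, neg_eq_zero.1 k1] at h2
      norm_num at h2
    · obtain ⟨k1, k2, k3⟩ := e3_eq_iff.1 h
      have hab : a = b := by
        rcases eq_or_lt_of_le ht.2 with rfl | hlt
        · have c1 := Real.neg_one_le_cos θ
          have c2 := Real.neg_one_le_cos φ
          have c3 := Real.cos_le_one θ
          have c4 := Real.cos_le_one φ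
          fin_cases a <;> fin_cases b <;> simp at k1 ⊢ <;> linarith
        · exact (sign_cases sheetSign_zero sheetSign_one (by linarith) (by linarith) k3).1
      subst hab
      exact ⟨rfl, exists_int_of_cos_sin_eq (by linarith) k2⟩
    · funext a θ; simp
    · funext a θ; simp [standardUnlinkCurve]
  exact ((s1.trans s2).trans s3).trans s4

/-! ### Closed braids with two components -/

/-- `Z a` traces the component `a` of a closed braid: one unit of time is one turn around the
axis, and each component closes up after `q` turns. -/
structure ClosedBraid (q : ℕ) (Z : Fin 2 → ℝ → ℝ × ℝ) : Prop where
  periodic : ∀ a x, Z a (x + q) = Z a x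
  injective : ∀ a b x (j : ℤ), Z a x = Z b (x + j) → a = b ∧ (q : ℤ) ∣ j
  off_axis : ∀ a x, -1 < (Z a x).1

/-- The link in three-space of a closed braid. -/
def closedBraidCurve (q : ℕ) (Z : Fin 2 → ℝ → ℝ × ℝ) (a : Fin 2) (θ : ℝ) : E3 :=
  bookPoint (q * θ) (Z a (q * θ / (2 * Real.pi)))

theorem bookPoint_injective {θ φ : ℝ} {x y : ℝ × ℝ} (hx : -1 < x.1) (hy : -1 < y.1)
    (h : bookPoint θ x = bookPoint φ y) : x = y ∧ ∃ n : ℤ, φ = θ + n * (2 * Real.pi) := by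
  obtain ⟨h1, h2, h3⟩ := e3_eq_iff.1 h
  have k1 := Real.sin_sq_add_cos_sq θ
  have k2 := Real.sin_sq_add_cos_sq φ
  have hr : (1 + x.1) ^ 2 = (1 + y.1) ^ 2 := by
    have : ((1 + x.1) * Real.cos θ) ^ 2 + ((1 + x.1) * Real.sin θ) ^ 2 =
      ((1 + y.1) * Real.cos φ) ^ 2 + ((1 + y.1) * Real.sin φ) ^ 2 := by rw [h1, h2]
    linear_combination this - (1 + x.1) ^ 2 * k1 + (1 + y.1) ^ 2 * k2
  have hr' : 1 + x.1 = 1 + y.1 := by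
    rwa [sq_eq_sq₀ (by linarith) (by linarith)] at hr
  rw [← hr'] at h1 h2
  have h0 : 1 + x.1 ≠ 0 := by linarith
  exact ⟨Prod.ext (by linarith) h3,
    exists_int_of_cos_sin_eq (mul_left_cancel₀ h0 h1) (mul_left_cancel₀ h0 h2)⟩

theorem contDiff_bookPoint {E : Type*} [NormedAddCommGroup E] [NormedSpace ℝ E] {f : E → ℝ}
    {g : E → ℝ × ℝ} (hf : ContDiff ℝ ∞ f) (hg : ContDiff ℝ ∞ g) :
    ContDiff ℝ ∞ (fun x => bookPoint (f x) (g x)) :=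
  contDiff_e3 ((contDiff_const.add hg.fst).mul (Real.contDiff_cos.comp hf))
    ((contDiff_const.add hg.fst).mul (Real.contDiff_sin.comp hf)) hg.snd

/-- A closed braid turns around the axis at constant angular speed `q` and stays off the axis, so
its velocity is never zero. Two parameters over the same half-plane differ by an integer number of
turns, and then disjointness of the strands decides. -/
theorem ClosedBraid.isLinkEmbedding {q : ℕ} (hq : 0 < q) {Z : Fin 2 → ℝ → ℝ × ℝ}
    (hZ : ClosedBraid q Z) (hs : ∀ a, ContDiff ℝ ∞ (Z a)) :
    IsLinkEmbedding (closedBraidCurve q Z) := by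
  have hq' : (q : ℝ) ≠ 0 := by positivity
  have hpi := Real.pi_pos
  have hlin : ContDiff ℝ ∞ (fun θ : ℝ => (q : ℝ) * θ) := contDiff_const.mul contDiff_id
  have hZs : ∀ a, ContDiff ℝ ∞ (fun θ : ℝ => Z a (q * θ / (2 * Real.pi))) := fun a =>
    (hs a).comp (hlin.div_const _)
  refine ⟨fun a => contDiff_bookPoint hlin (hZs a), fun a θ => ?_, fun a θ => ?_,
    fun a b θ φ h => ?_⟩
  · have e1 : (q : ℝ) * (θ + 2 * Real.pi) = q * θ + q * (2 * Real.pi) := by ring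
    have e2 : (q * θ + q * (2 * Real.pi)) / (2 * Real.pi) = q * θ / (2 * Real.pi) + q := by
      field_simp
    simp only [closedBraidCurve, bookPoint, e1, e2, hZ.periodic, Real.cos_add_nat_mul_two_pi,
      Real.sin_add_nat_mul_two_pi]
  · have hd1 : HasDerivAt (fun θ : ℝ => 1 + (Z a (q * θ / (2 * Real.pi))).1)
        (deriv (fun θ : ℝ => 1 + (Z a (q * θ / (2 * Real.pi))).1) θ) θ :=
      ((contDiff_const.add (hZs a).fst).differentiable (by simp)).differentiableAt.hasDerivAt
    have hd2 : HasDerivAt (fun θ : ℝ => (Z a (q * θ / (2 * Real.pi))).2)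
        (deriv (fun θ : ℝ => (Z a (q * θ / (2 * Real.pi))).2) θ) θ :=
      ((hZs a).snd.differentiable (by simp)).differentiableAt.hasDerivAt
    have hl : HasDerivAt (fun θ : ℝ => (q : ℝ) * θ) q θ := by
      simpa using (hasDerivAt_id θ).const_mul (q : ℝ)
    refine deriv_e3_ne_zero (hd1.mul hl.cos) (hd1.mul hl.sin) hd2 ?_
    rintro ⟨k1, k2, -⟩
    have k := Real.sin_sq_add_cos_sq (q * θ)
    have h0 := hZ.off_axis a (q * θ / (2 * Real.pi))
    -- This product is the component of the velocity in the angular direction: radius times angular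
    -- speed.
    have : (1 + (Z a (q * θ / (2 * Real.pi))).1) * q = 0 := by
      linear_combination -Real.sin (q * θ) * k1 + Real.cos (q * θ) * k2 -
        (1 + (Z a (q * θ / (2 * Real.pi))).1) * q * k
    rcases mul_eq_zero.1 this with h | h
    · linarith
    · exact hq' h
  · obtain ⟨h1, n, h2⟩ := bookPoint_injective (hZ.off_axis _ _) (hZ.off_axis _ _) h
    have e : q * φ / (2 * Real.pi) = q * θ / (2 * Real.pi) + n := by
      rw [h2]; field_simp
    rw [e] at h1
    obtain ⟨hab, m, hm⟩ := hZ.injective _ _ _ _ h1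
    refine ⟨hab, m, ?_⟩
    have : (q : ℝ) * φ = q * (θ + m * (2 * Real.pi)) := by
      rw [h2, hm]; push_cast; ring
    exact mul_left_cancel₀ hq' this

/-- Homotopy of closed braids through closed braids. -/
def BraidHomotopic (q : ℕ) (Z Z' : Fin 2 → ℝ → ℝ × ℝ) : Prop :=
  ∃ H : ℝ → Fin 2 → ℝ → ℝ × ℝ, (∀ a, Continuous fun p : ℝ × ℝ => H p.1 a p.2) ∧
    (∀ t ∈ Set.Icc (0 : ℝ) 1, ClosedBraid q (H t)) ∧ H 0 = Z ∧ H 1 = Z'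

theorem BraidHomotopic.trans {q : ℕ} {Z Z' Z'' : Fin 2 → ℝ → ℝ × ℝ}
    (h : BraidHomotopic q Z Z') (h' : BraidHomotopic q Z' Z'') : BraidHomotopic q Z Z'' := by
  obtain ⟨H, h1, h2, h3, h4⟩ := h
  obtain ⟨K, k1, k2, k3, k4⟩ := h'
  refine ⟨fun t a x => if t ≤ 1 / 2 then H (2 * t) a x else K (2 * t - 1) a x,
    fun a => ?_, fun t ht => ?_, ?_, ?_⟩
  · refine Continuous.if_le ((h1 a).comp ((continuous_const.mul continuous_fst).prodMk
      continuous_snd)) ((k1 a).comp (((continuous_const.mul continuous_fst).sub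
      continuous_const).prodMk continuous_snd)) continuous_fst continuous_const ?_
    intro p hp
    rw [hp]
    norm_num [h4, k3]
  · by_cases h : t ≤ 1 / 2
    · simp only [h, if_true]
      exact h2 _ ⟨by linarith [ht.1], by linarith⟩
    · simp only [h, if_false]
      exact k2 _ ⟨by linarith [ht.1], by linarith [ht.2]⟩
  · simp [h3]
  · norm_num [k4]

theorem BraidHomotopic.of_segment {q : ℕ} {Z Z' : Fin 2 → ℝ → ℝ × ℝ}
    (hZ : ∀ a, Continuous (Z a)) (hZ' : ∀ a, Continuous (Z' a))
    (h : ∀ t ∈ Set.Icc (0 : ℝ) 1, ClosedBraid q (fun a x => (1 - t) • Z a x + t • Z' a x)) :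
    BraidHomotopic q Z Z' :=
  ⟨fun t a x => (1 - t) • Z a x + t • Z' a x, fun a =>
    ((continuous_const.sub continuous_fst).smul ((hZ a).comp continuous_snd)).add
      (continuous_fst.smul ((hZ' a).comp continuous_snd)), h, by simp, by simp⟩

/-- Moving the starting half-plane around the axis is the geometric form of conjugation in the braid
group. -/
theorem BraidHomotopic.shift {q : ℕ} {Z : Fin 2 → ℝ → ℝ × ℝ} (hZ : ClosedBraid q Z)
    (hc : ∀ a, Continuous (Z a)) (s : ℝ) : BraidHomotopic q Z (fun a x => Z a (x + s)) := by
  refine ⟨fun t a x => Z a (x + t * s), fun a => (hc a).comp (by fun_prop), fun t _ =>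
    ⟨fun a x => ?_, fun a b x j h => ?_, fun a x => hZ.off_axis _ _⟩, by simp, by simp⟩
  · show Z a (x + q + t * s) = Z a (x + t * s)
    rw [← hZ.periodic a (x + t * s)]; congr 1; ring
  · apply hZ.injective a b (x + t * s) j
    have h' : Z a (x + t * s) = Z b (x + j + t * s) := h
    rw [h']; congr 1; ring

/-! ### Smoothing homotopies of closed braids -/

/-- Convolution with a narrow bump is smooth and commutes with translation, so periodicity survives;
uniform continuity controls the error. -/
theorem exists_smooth_periodic_approx {q : ℕ} (hq : 0 < q) {f : ℝ × ℝ → ℝ × ℝ}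
    (hf : Continuous f) (hp : ∀ t x, f (t, x + q) = f (t, x)) {δ : ℝ} (hδ : 0 < δ) :
    ∃ g : ℝ × ℝ → ℝ × ℝ, ContDiff ℝ ∞ g ∧ (∀ t x, g (t, x + q) = g (t, x)) ∧
      ∀ t ∈ Set.Icc (0 : ℝ) 1, ∀ x, dist (g (t, x)) (f (t, x)) ≤ δ := by
  -- One period is enlarged by 1 on every side, since the bump has radius at most 1.
  have hK : IsCompact (Set.Icc (-1 : ℝ) 2 ×ˢ Set.Icc (-1 : ℝ) (q + 1)) :=
    isCompact_Icc.prod isCompact_Icc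
  obtain ⟨r, hr, hru⟩ := Metric.uniformContinuousOn_iff.1
    (hK.uniformContinuousOn_of_continuous hf.continuousOn) δ hδ
  let φ : ContDiffBump (0 : ℝ × ℝ) := ⟨min r 1 / 2, min r 1, by positivity, by
    have : 0 < min r 1 := by positivity
    linarith⟩
  let g : ℝ × ℝ → ℝ × ℝ := MeasureTheory.convolution (φ.normed MeasureTheory.volume) f
    (ContinuousLinearMap.lsmul ℝ ℝ) MeasureTheory.volume
  have hg : ∀ t x, g (t, x + q) = g (t, x) := by
    intro t x
    simp only [g, MeasureTheory.convolution_def]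
    congr 1
    funext p
    have : ((t, x + q) : ℝ × ℝ) - p = ((t - p.1), (x - p.2) + q) := by
      ext <;> simp; ring
    rw [this, hp]
    rfl
  refine ⟨g, φ.hasCompactSupport_normed.contDiff_convolution_left _ φ.contDiff_normed
    hf.locallyIntegrable, hg, fun t ht x => ?_⟩
  have hper : Function.Periodic (fun x => dist (g (t, x)) (f (t, x))) q := fun x => by
    simp only [hg, hp]
  obtain ⟨y, hy, hxy⟩ := hper.exists_mem_Ico₀ (by positivity : (0 : ℝ) < q) x
  refine hxy.trans_le (φ.dist_normed_convolution_le hf.aestronglyMeasurable fun p hp' => ?_)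
  have hp1 : dist p (t, y) < min r 1 := hp'
  have hp2 : dist p (t, y) < 1 := hp1.trans_le (min_le_right _ _)
  rw [Prod.dist_eq, max_lt_iff, Real.dist_eq, Real.dist_eq, abs_lt, abs_lt] at hp2
  refine (hru p ⟨⟨?_, ?_⟩, ?_, ?_⟩ (t, y) ⟨⟨?_, ?_⟩, ?_, ?_⟩
    (hp1.trans_le (min_le_left _ _))).le <;> simp only at hp2 ⊢ <;>
    linarith [ht.1, ht.2, hy.1, hy.2]

theorem exists_uniform_lower_bound {q : ℕ} (hq : 0 < q) {f : ℝ × ℝ → ℝ} (hf : Continuous f)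
    (hp : ∀ t x, f (t, x + q) = f (t, x)) (hpos : ∀ t ∈ Set.Icc (0 : ℝ) 1, ∀ x, 0 < f (t, x)) :
    ∃ ε > 0, ∀ t ∈ Set.Icc (0 : ℝ) 1, ∀ x, ε ≤ f (t, x) := by
  have hK : IsCompact (Set.Icc (0 : ℝ) 1 ×ˢ Set.Icc (0 : ℝ) q) :=
    isCompact_Icc.prod isCompact_Icc
  obtain ⟨p, hpK, hmin⟩ := hK.exists_isMinOn ⟨(0, 0), by simp⟩ hf.continuousOn
  refine ⟨f p, hpos p.1 hpK.1 p.2, fun t ht x => ?_⟩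
  have hper : Function.Periodic (fun x => f (t, x)) q := fun x => hp t x
  obtain ⟨y, hy, hxy⟩ := hper.exists_mem_Ico₀ (by positivity : (0 : ℝ) < q) x
  have hm : f p ≤ f (t, y) := hmin (Set.mk_mem_prod ht ⟨hy.1, hy.2.le⟩)
  exact hm.trans hxy.ge

theorem ClosedBraid.periodic_int {q : ℕ} {Z : Fin 2 → ℝ → ℝ × ℝ} (hZ : ClosedBraid q Z)
    (a : Fin 2) (x : ℝ) (m : ℤ) : Z a (x + m * q) = Z a x := by
  have h : Function.Periodic (Z a) (q : ℝ) := hZ.periodic a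
  exact h.int_mul m x

/-- Only the residue of `j` modulo `q` matters, so finitely many positive continuous periodic
functions have to be bounded below, and compactness does this for each of them. -/
theorem exists_closedBraid_margin {q : ℕ} (hq : 0 < q) {H : ℝ → Fin 2 → ℝ → ℝ × ℝ}
    (hc : ∀ a, Continuous fun p : ℝ × ℝ => H p.1 a p.2)
    (hp : ∀ t a x, H t a (x + q) = H t a x)
    (hb : ∀ t ∈ Set.Icc (0 : ℝ) 1, ClosedBraid q (H t)) :
    ∃ ε > 0, (∀ t ∈ Set.Icc (0 : ℝ) 1, ∀ a b x (j : ℤ), ¬ (a = b ∧ (q : ℤ) ∣ j) →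
      ε ≤ dist (H t a x) (H t b (x + j))) ∧
      ∀ t ∈ Set.Icc (0 : ℝ) 1, ∀ a x, -1 + ε ≤ (H t a x).1 := by
  have hpair : ∀ i : Fin 2 × Fin 2 × Fin q, ∃ ε > 0, ¬ (i.1 = i.2.1 ∧ (q : ℤ) ∣ (i.2.2 : ℕ)) →
      ∀ t ∈ Set.Icc (0 : ℝ) 1, ∀ x, ε ≤ dist (H t i.1 x) (H t i.2.1 (x + (i.2.2 : ℕ))) := by
    rintro ⟨a, b, j⟩
    by_cases hn : a = b ∧ (q : ℤ) ∣ (j : ℕ)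
    · exact ⟨1, one_pos, fun h => absurd hn h⟩
    obtain ⟨ε, h0, h1⟩ := exists_uniform_lower_bound hq
      (f := fun p => dist (H p.1 a p.2) (H p.1 b (p.2 + (j : ℕ))))
      ((hc a).dist ((hc b).comp (continuous_fst.prodMk (continuous_snd.add continuous_const))))
      (fun t x => by
        have : x + q + (j : ℕ) = x + (j : ℕ) + (q : ℝ) := by ring
        simp only [this, hp])
      (fun t ht x => dist_pos.2 fun h => hn ((hb t ht).injective a b x (j : ℕ) (by simpa using h)))
    exact ⟨ε, h0, fun _ => h1⟩
  have hax : ∀ a : Fin 2, ∃ ε > 0, ∀ t ∈ Set.Icc (0 : ℝ) 1, ∀ x, ε ≤ 1 + (H t a x).1 := fun a =>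
    exists_uniform_lower_bound hq (f := fun p => 1 + (H p.1 a p.2).1)
      (continuous_const.add (hc a).fst) (fun t x => by simp only [hp])
      (fun t ht x => by linarith [(hb t ht).off_axis a x])
  choose ε h0 h1 using hpair
  choose η k0 k1 using hax
  have : Nonempty (Fin q) := ⟨⟨0, hq⟩⟩
  obtain ⟨i, hi⟩ := Finite.exists_min ε
  obtain ⟨a₀, ha₀⟩ := Finite.exists_min η
  refine ⟨min (ε i) (η a₀), lt_min (h0 i) (k0 a₀), fun t ht a b x j hj => ?_, fun t ht a x => ?_⟩
  · have hqz : (0 : ℤ) < q := by exact_mod_cast hq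
    have hj0 := Int.emod_nonneg j hqz.ne'
    have hj1 := Int.emod_lt_of_pos j hqz
    obtain ⟨k, hk⟩ : ∃ k : Fin q, ((k : ℕ) : ℤ) = j % q :=
      ⟨⟨(j % q).toNat, by omega⟩, by simp [hj0]⟩
    have e : x + (j : ℝ) = x + ((k : ℕ) : ℝ) + ((j / q : ℤ) : ℝ) * q := by
      have h2 : (j : ℝ) = (((k : ℕ) : ℤ) : ℝ) + ((j / q : ℤ) : ℝ) * ((q : ℤ) : ℝ) := by
        rw [hk]
        exact_mod_cast (by rw [mul_comm]; exact (Int.emod_add_mul_ediv j q).symm)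
      rw [h2]; push_cast; ring
    rw [e, (hb t ht).periodic_int]
    refine (min_le_left _ _).trans ((hi (a, b, k)).trans (h1 (a, b, k) ?_ t ht x))
    rintro ⟨hab, hd⟩
    exact hj ⟨hab, Int.dvd_of_emod_eq_zero (by
      rw [← hk]
      have : ((k : ℕ) : ℤ) % q = 0 := Int.emod_eq_zero_of_dvd hd
      rwa [Int.emod_eq_of_lt (by omega) (by rw [hk]; exact hj1)] at this)⟩
  · linarith [min_le_right (ε i) (η a₀), ha₀ a, k1 a t ht x]

/-- Being a closed braid is an open condition with a uniform margin ε along the homotopy. A smooth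
periodic family within ε/4 of it therefore still consists of closed braids, because two strands
together lose at most ε/2. -/
theorem BraidHomotopic.paramIsotopic {q : ℕ} (hq : 0 < q) {Z Z' : Fin 2 → ℝ → ℝ × ℝ}
    (h : BraidHomotopic q Z Z') (hs : ∀ a, ContDiff ℝ ∞ (Z a)) (hs' : ∀ a, ContDiff ℝ ∞ (Z' a)) :
    ParamIsotopic (closedBraidCurve q Z) (closedBraidCurve q Z') := by
  obtain ⟨H₀, hc₀, hb₀, h0, h1⟩ := h
  -- Clamping the time makes every stage a closed braid; the convolution also samples times outside
  -- [0, 1].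
  let H : ℝ → Fin 2 → ℝ → ℝ × ℝ := fun t => H₀ (max 0 (min 1 t))
  have hH : ∀ t ∈ Set.Icc (0 : ℝ) 1, H t = H₀ t := fun t ht => by
    simp [H, ht.1, ht.2]
  have hmem : ∀ t : ℝ, max 0 (min 1 t) ∈ Set.Icc (0 : ℝ) 1 := fun t => by simp
  have hc : ∀ a, Continuous fun p : ℝ × ℝ => H p.1 a p.2 := fun a =>
    (hc₀ a).comp ((continuous_const.max (continuous_const.min continuous_fst)).prodMk
      continuous_snd)
  have hb : ∀ t, ClosedBraid q (H t) := fun t => hb₀ _ (hmem t)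
  have hp : ∀ t a x, H t a (x + q) = H t a x := fun t => (hb t).periodic
  have hZ : H 0 = Z := by rw [hH 0 (by simp), h0]
  have hZ' : H 1 = Z' := by rw [hH 1 (by simp), h1]
  obtain ⟨ε, hε, m1, m2⟩ := exists_closedBraid_margin hq hc hp (fun t _ => hb t)
  have happ := fun a => exists_smooth_periodic_approx hq (hc a) (fun t x => hp t a x)
    (by positivity : 0 < ε / 8)
  choose g g1 g2 g3 using happ
  -- The correction, affine in t, restores the exact end braids, which are smooth by hypothesis. It
  -- costs at most another ε/8.
  let K : ℝ → Fin 2 → ℝ → ℝ × ℝ := fun t a x => g a (t, x) + ((1 - t) • (Z a x - g a (0, x)) +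
    t • (Z' a x - g a (1, x)))
  have near : ∀ t ∈ Set.Icc (0 : ℝ) 1, ∀ a x, dist (K t a x) (H t a x) ≤ ε / 4 := by
    intro t ht a x
    have n0 : ‖Z a x - g a (0, x)‖ ≤ ε / 8 := by
      rw [← dist_eq_norm, dist_comm, ← hZ]; exact g3 a 0 (by simp) x
    have n1 : ‖Z' a x - g a (1, x)‖ ≤ ε / 8 := by
      rw [← dist_eq_norm, dist_comm, ← hZ']; exact g3 a 1 (by simp) x
    have n2 : ‖g a (t, x) - H t a x‖ ≤ ε / 8 := by
      rw [← dist_eq_norm]; exact g3 a t ht x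
    have n3 : ‖(1 - t) • (Z a x - g a (0, x)) + t • (Z' a x - g a (1, x))‖ ≤ ε / 8 := by
      refine (norm_add_le _ _).trans ?_
      rw [norm_smul, norm_smul, Real.norm_of_nonneg ht.1,
        Real.norm_of_nonneg (by linarith [ht.2] : (0 : ℝ) ≤ 1 - t)]
      nlinarith [ht.1, ht.2]
    have e : K t a x - H t a x = (g a (t, x) - H t a x) +
      ((1 - t) • (Z a x - g a (0, x)) + t • (Z' a x - g a (1, x))) := by simp only [K]; abel
    rw [dist_eq_norm, e]
    exact (norm_add_le _ _).trans (by linarith)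
  have hKs : ∀ a, ContDiff ℝ ∞ (fun p : ℝ × ℝ => K p.1 a p.2) := by
    intro a
    exact (g1 a).add (((contDiff_const.sub contDiff_fst).smul (((hs a).comp contDiff_snd).sub
      ((g1 a).comp (contDiff_const.prodMk contDiff_snd)))).add (contDiff_fst.smul
      (((hs' a).comp contDiff_snd).sub ((g1 a).comp (contDiff_const.prodMk contDiff_snd)))))
  have hKb : ∀ t ∈ Set.Icc (0 : ℝ) 1, ClosedBraid q (K t) := by
    intro t ht
    refine ⟨fun a x => ?_, fun a b x j h => ?_, fun a x => ?_⟩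
    · simp only [K, g2, ← hZ, ← hZ', hp]
    · by_contra hn
      have := m1 t ht a b x j hn
      have d1 := near t ht a x
      have d2 := near t ht b (x + j)
      rw [h] at d1
      have := dist_triangle_left (H t a x) (H t b (x + j)) (K t b (x + j))
      linarith
    · have d := near t ht a x
      rw [Prod.dist_eq] at d
      have d' := (le_max_left _ _).trans d
      rw [Real.dist_eq, abs_le] at d'
      linarith [m2 t ht a x, d'.1]
  have hlin : ContDiff ℝ ∞ (fun p : ℝ × ℝ => (q : ℝ) * p.2) := contDiff_const.mul contDiff_snd
  refine ⟨fun t => closedBraidCurve q (K t), fun a => ?_, fun t ht => ?_, ?_, ?_⟩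
  · exact contDiff_bookPoint hlin ((hKs a).comp (contDiff_fst.prodMk (hlin.div_const _)))
  · exact (hKb t ht).isLinkEmbedding hq fun a => (hKs a).comp (contDiff_const.prodMk contDiff_id)
  · have e : K 0 = Z := by funext a x; simp [K]
    exact congrArg _ e
  · have e : K 1 = Z' := by funext a x; simp [K]
    exact congrArg _ e

/-- The closed braid of the two torus curves. -/
def torusBraid (q : ℕ) (a : Fin 2) (x : ℝ) : ℝ × ℝ :=
  (1 - Real.sin (2 * Real.pi * x / q), sheetSign a * (5 + Real.cos (2 * Real.pi * x / q)))

theorem closedBraidCurve_torusBraid {q : ℕ} (hq : 0 < q) :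
    closedBraidCurve q (torusBraid q) = torusCurve q := by
  funext a θ
  have hq' : (q : ℝ) ≠ 0 := by positivity
  have e : 2 * Real.pi * (q * θ / (2 * Real.pi)) / q = θ := by
    field_simp
  simp only [closedBraidCurve, torusBraid, bookPoint, torusCurve, e, e3_eq_iff, and_true]
  constructor <;> ring

theorem contDiff_torusBraid (q : ℕ) (a : Fin 2) : ContDiff ℝ ∞ (torusBraid q a) := by
  have h : ContDiff ℝ ∞ (fun x : ℝ => 2 * Real.pi * x / q) :=
    (contDiff_const.mul contDiff_id).div_const _
  exact (contDiff_const.sub (Real.contDiff_sin.comp h)).prodMk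
    (contDiff_const.mul (contDiff_const.add (Real.contDiff_cos.comp h)))

theorem isUnlink_of_braidHomotopic_torusBraid {q : ℕ} (hq : 0 < q) {Z : Fin 2 → ℝ → ℝ × ℝ}
    (hs : ∀ a, ContDiff ℝ ∞ (Z a)) (h : BraidHomotopic q Z (torusBraid q)) :
    IsUnlink 2 (linkImage (closedBraidCurve q Z)) := by
  have h1 := h.paramIsotopic hq hs (contDiff_torusBraid q)
  rw [closedBraidCurve_torusBraid hq] at h1
  exact (h1.trans (torusCurve_isotopic_standardUnlink q)).linkIsotopic

/-! ### Configurations of points and layered paths -/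

/-- Configurations of `m` labelled distinct points in the half-plane to the right of `-1`. -/
abbrev Conf (m : ℕ) := {z : Fin m → ℝ × ℝ // Function.Injective z ∧ ∀ k, -1 < (z k).1}

/-- The configuration with the point labelled `k` at `(σ k, 0)`. -/
def gridConf {m : ℕ} (σ : Equiv.Perm (Fin m)) : Conf m :=
  ⟨fun k => (((σ k : ℕ) : ℝ), 0), fun k l h => by
    have h1 : ((σ k : ℕ) : ℝ) = ((σ l : ℕ) : ℝ) := congrArg Prod.fst h
    exact σ.injective (Fin.ext (by exact_mod_cast h1)),
    fun k => by
      have : (0 : ℝ) ≤ ((σ k : ℕ) : ℝ) := Nat.cast_nonneg _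
      simp only
      linarith⟩

/-- The half-plane is convex, so only collisions of points can obstruct the straight-line homotopy.
-/
theorem homotopic_of_segment {m : ℕ} {a b : Conf m} (γ γ' : Path a b)
    (h : ∀ t u : unitInterval, Function.Injective
      (fun k => (1 - (t : ℝ)) • (γ u).1 k + (t : ℝ) • (γ' u).1 k)) : γ.Homotopic γ' := by
  have hax : ∀ (t u : unitInterval) k, -1 < ((1 - (t : ℝ)) • (γ u).1 k + (t : ℝ) • (γ' u).1 k).1 := by
    intro t u k
    have h1 := (γ u).2.2 k
    have h2 := (γ' u).2.2 k
    have t0 := t.2.1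
    have t1 := t.2.2
    simp only [Prod.fst_add, Prod.smul_fst, smul_eq_mul]
    rcases eq_or_lt_of_le t0 with h0 | h0
    · rw [← h0]; linarith
    · nlinarith
  have ha : ∀ t : ℝ, (fun k => (1 - t) • a.1 k + t • a.1 k) = a.1 := fun t => by
    funext k; rw [← add_smul]; simp
  have hb : ∀ t : ℝ, (fun k => (1 - t) • b.1 k + t • b.1 k) = b.1 := fun t => by
    funext k; rw [← add_smul]; simp
  have hγ : Continuous fun p : unitInterval × unitInterval => (γ p.2).1 :=
    continuous_subtype_val.comp (γ.continuous.comp continuous_snd)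
  have hγ' : Continuous fun p : unitInterval × unitInterval => (γ' p.2).1 :=
    continuous_subtype_val.comp (γ'.continuous.comp continuous_snd)
  refine ⟨⟨⟨⟨fun p => ⟨fun k => (1 - (p.1 : ℝ)) • (γ p.2).1 k + (p.1 : ℝ) • (γ' p.2).1 k,
    h p.1 p.2, hax p.1 p.2⟩, ?_⟩, ?_, ?_⟩, ?_⟩⟩
  · refine Continuous.subtype_mk (continuous_pi fun k => ?_) _
    have c1 : Continuous fun p : unitInterval × unitInterval => (γ p.2).1 k := (continuous_apply k).comp hγ
    have c2 : Continuous fun p : unitInterval × unitInterval => (γ' p.2).1 k := (continuous_apply k).comp hγ'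
    have c3 : Continuous fun p : unitInterval × unitInterval => (p.1 : ℝ) := continuous_subtype_val.comp continuous_fst
    exact ((continuous_const.sub c3).smul c1).add (c3.smul c2)
  · intro u
    apply Subtype.ext
    simp
  · intro u
    apply Subtype.ext
    simp
  · intro t u hu
    apply Subtype.ext
    rcases hu with rfl | hu
    · simp [ha]
    · rw [Set.mem_singleton_iff] at hu
      subst hu
      simp [hb]

/-- Whenever two points of the path have the same first coordinate, the one with the larger
value of `h` lies above the other one. -/
def LayeredPath {m : ℕ} (h : Fin m → ℝ) {a b : Conf m} (γ : Path a b) : Prop :=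
  ∀ (u : unitInterval) (k l : Fin m), k ≠ l → ((γ u).1 k).1 = ((γ u).1 l).1 →
    0 < (((γ u).1 k).2 - ((γ u).1 l).2) * (h k - h l)

/-- Both the old height difference and the new one have the sign of `h k - h l`, so no convex
combination of them vanishes. -/
theorem LayeredPath.spread_injective {m : ℕ} {h : Fin m → ℝ} (hh : Function.Injective h)
    {a b : Conf m} {γ : Path a b} (hγ : LayeredPath h γ)
    (ha : ∀ k, (a.1 k).2 = 0) (hb : ∀ k, (b.1 k).2 = 0) (t u : unitInterval) {k l : Fin m}
    (h1 : ((γ u).1 k).1 = ((γ u).1 l).1)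
    (h2 : (1 - (t : ℝ)) * ((γ u).1 k).2 + t * (h k * (u * (1 - u))) =
      (1 - (t : ℝ)) * ((γ u).1 l).2 + t * (h l * (u * (1 - u)))) : k = l := by
  by_contra hkl
  have hp := hγ u k l hkl h1
  have hne : h k - h l ≠ 0 := sub_ne_zero.2 fun h => hkl (hh h)
  have hsq : 0 < (h k - h l) ^ 2 := by positivity
  -- At the ends of the path all heights are 0, which contradicts the strict inequality `hp`; so `u
  -- * (1 - u)` is positive.
  have hu0 : (0 : ℝ) < u := by
    rcases eq_or_lt_of_le u.2.1 with h0 | h0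
    · have : u = 0 := Subtype.ext h0.symm
      subst this
      simp [ha] at hp
    · exact h0
  have hu1 : (u : ℝ) < 1 := by
    rcases eq_or_lt_of_le u.2.2 with h0 | h0
    · have : u = 1 := Subtype.ext h0
      subst this
      simp [hb] at hp
    · exact h0
  have hb' : 0 < (u : ℝ) * (1 - u) := mul_pos hu0 (by linarith)
  have e : (1 - (t : ℝ)) * ((((γ u).1 k).2 - ((γ u).1 l).2) * (h k - h l)) +
      t * ((h k - h l) ^ 2 * (u * (1 - u))) = 0 := by
    linear_combination (h k - h l) * h2
  have p1 : 0 < (h k - h l) ^ 2 * ((u : ℝ) * (1 - u)) := mul_pos hsq hb'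
  have t0 := t.2.1
  have t1 := t.2.2
  rcases eq_or_lt_of_le t0 with h0 | h0
  · rw [← h0] at e; linarith
  · nlinarith [mul_pos h0 p1, mul_nonneg (sub_nonneg.2 t1) hp.le]

/-- The path in which the point with label `k` is moved to height `h k * u * (1 - u)`. -/
def LayeredPath.spread {m : ℕ} {h : Fin m → ℝ} (hh : Function.Injective h)
    {a b : Conf m} {γ : Path a b} (hγ : LayeredPath h γ)
    (ha : ∀ k, (a.1 k).2 = 0) (hb : ∀ k, (b.1 k).2 = 0) : Path a b where
  toFun u := ⟨fun k => (((γ u).1 k).1, h k * (u * (1 - u))), fun k l hkl => by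
    rw [Prod.mk.injEq] at hkl
    exact hγ.spread_injective hh ha hb 1 u hkl.1 (by simpa using hkl.2), (γ u).2.2⟩
  continuous_toFun := by
    refine Continuous.subtype_mk (continuous_pi fun k => ?_) _
    have c1 : Continuous fun u : unitInterval => (γ u).1 k :=
      (continuous_apply k).comp (continuous_subtype_val.comp γ.continuous)
    exact c1.fst.prodMk (by fun_prop)
  source' := by
    apply Subtype.ext
    funext k
    simp [Prod.ext_iff, ha]
  target' := by
    apply Subtype.ext
    funext k
    simp [Prod.ext_iff, hb]

theorem LayeredPath.homotopic_spread {m : ℕ} {h : Fin m → ℝ} (hh : Function.Injective h)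
    {a b : Conf m} {γ : Path a b} (hγ : LayeredPath h γ)
    (ha : ∀ k, (a.1 k).2 = 0) (hb : ∀ k, (b.1 k).2 = 0) :
    γ.Homotopic (hγ.spread hh ha hb) := by
  refine homotopic_of_segment _ _ fun t u k l hkl => ?_
  rw [Prod.ext_iff] at hkl
  obtain ⟨h1, h2⟩ := hkl
  refine hγ.spread_injective hh ha hb t u ?_ h2
  simp only [LayeredPath.spread, Prod.fst_add, Prod.smul_fst, smul_eq_mul, Path.coe_mk_mk] at h1
  linarith

/-- After spreading, each point moves at a height that depends only on its label and the time.
Distinct labels then have distinct heights at interior times, so the first coordinates can be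
interpolated freely. -/
theorem LayeredPath.homotopic {m : ℕ} {h : Fin m → ℝ} (hh : Function.Injective h)
    {a b : Conf m} {γ γ' : Path a b} (hγ : LayeredPath h γ) (hγ' : LayeredPath h γ')
    (ha : ∀ k, (a.1 k).2 = 0) (hb : ∀ k, (b.1 k).2 = 0) : γ.Homotopic γ' := by
  refine ((hγ.homotopic_spread hh ha hb).trans ?_).trans (hγ'.homotopic_spread hh ha hb).symm
  refine homotopic_of_segment _ _ fun t u k l hkl => ?_
  rw [Prod.ext_iff] at hkl
  obtain ⟨h1, h2⟩ := hkl
  simp only [LayeredPath.spread, Prod.fst_add, Prod.smul_fst, smul_eq_mul, Path.coe_mk_mk,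
    Prod.snd_add, Prod.smul_snd] at h1 h2
  have h3 : (h k - h l) * ((u : ℝ) * (1 - u)) = 0 := by linear_combination h2
  by_contra hkl
  have hne : h k - h l ≠ 0 := sub_ne_zero.2 fun h => hkl (hh h)
  rcases mul_eq_zero.1 ((mul_eq_zero.1 h3).resolve_left hne) with h0 | h0
  · have : u = 0 := Subtype.ext h0
    subst this
    rw [γ.source, γ'.source] at h1
    exact hkl (a.2.1 (Prod.ext (by linarith) (by rw [ha, ha])))
  · have : u = 1 := Subtype.ext (by simp only [Set.Icc.coe_one]; linarith)
    subst this
    rw [γ.target, γ'.target] at h1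
    exact hkl (b.2.1 (Prod.ext (by linarith) (by rw [hb, hb])))

/-! ### Closing up a motion of strands -/

/-- `G k x` is the position at time `x` of the strand that starts at `(k, 0)`; the motion takes
place between times `0` and `1`, and permutes the starting points by `τ`. -/
structure StrandMotion {m : ℕ} (τ : Equiv.Perm (Fin m)) (G : Fin m → ℝ → ℝ × ℝ) : Prop where
  start : ∀ k x, x ≤ 0 → G k x = (((k : ℕ) : ℝ), 0)
  finish : ∀ k x, 1 ≤ x → G k x = (((τ k : ℕ) : ℝ), 0)
  injective : ∀ x, Function.Injective fun k => G k x
  off_axis : ∀ k x, -1 < (G k x).1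

/-- The point labelled `s a` at time zero, followed through repetitions of a motion. -/
def braidLoop {m : ℕ} (τ : Equiv.Perm (Fin m)) (s : Fin 2 → Fin m) (G : Fin m → ℝ → ℝ × ℝ)
    (a : Fin 2) (x : ℝ) : ℝ × ℝ :=
  G ((τ ^ ⌊x⌋) (s a)) (Int.fract x)

/-- The orbits of `s 0` and `s 1` under `τ` are disjoint and have `q` elements. -/
structure OrbitsOfLength {m : ℕ} (q : ℕ) (τ : Equiv.Perm (Fin m)) (s : Fin 2 → Fin m) : Prop where
  closed : ∀ a, (τ ^ q) (s a) = s a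
  free : ∀ a b (j : ℤ), s a = (τ ^ j) (s b) → a = b ∧ (q : ℤ) ∣ j

theorem StrandMotion.closedBraid {m q : ℕ} {τ : Equiv.Perm (Fin m)} {G : Fin m → ℝ → ℝ × ℝ}
    (hG : StrandMotion τ G) {s : Fin 2 → Fin m} (hs : OrbitsOfLength q τ s) :
    ClosedBraid q (braidLoop τ s G) := by
  refine ⟨fun a x => ?_, fun a b x j h => ?_, fun a x => hG.off_axis _ _⟩
  · simp only [braidLoop, Int.floor_add_natCast, Int.fract_add_natCast, zpow_add, zpow_natCast,
      Equiv.Perm.mul_apply, hs.closed]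
  · simp only [braidLoop, Int.floor_add_intCast, Int.fract_add_intCast, zpow_add,
      Equiv.Perm.mul_apply] at h
    exact hs.free a b j ((τ ^ ⌊x⌋).injective (hG.injective _ h))

/-- Near an integer time the repetitions before and after it are both at hand, and each is constant
while the other moves. Their sum minus the junction value is one formula across the integer, from
which smoothness and joint continuity follow. -/
theorem braidLoop_eq_on_Ioo {m : ℕ} {τ : Equiv.Perm (Fin m)} {G : Fin m → ℝ → ℝ × ℝ}
    (hG : StrandMotion τ G) (s : Fin 2 → Fin m) (a : Fin 2) (n : ℤ) {x : ℝ}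
    (hx : x ∈ Set.Ioo ((n : ℝ) - 1) (n + 1)) :
    braidLoop τ s G a x = G ((τ ^ (n - 1)) (s a)) (x - n + 1) + G ((τ ^ n) (s a)) (x - n) -
      (((((τ ^ n) (s a) : Fin m) : ℕ) : ℝ), 0) := by
  rcases lt_or_ge x n with h | h
  · have hf : ⌊x⌋ = n - 1 := by
      rw [Int.floor_eq_iff]; push_cast; exact ⟨hx.1.le, by linarith⟩
    rw [hG.start _ (x - n) (by linarith)]
    simp only [braidLoop, Int.fract, hf, add_sub_cancel_right]
    congr 1
    push_cast; ring
  · have hf : ⌊x⌋ = n := by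
      rw [Int.floor_eq_iff]; exact ⟨h, hx.2⟩
    have hτ : τ ((τ ^ (n - 1)) (s a)) = (τ ^ n) (s a) := by
      rw [← Equiv.Perm.mul_apply, ← zpow_one_add]; congr 2; ring
    rw [hG.finish _ (x - n + 1) (by linarith), hτ]
    simp only [braidLoop, Int.fract, hf, add_sub_cancel_left]

theorem mem_Ioo_floor (x : ℝ) : x ∈ Set.Ioo ((⌊x⌋ : ℝ) - 1) (⌊x⌋ + 1) :=
  ⟨by linarith [Int.floor_le x], Int.lt_floor_add_one x⟩

theorem contDiff_braidLoop {m : ℕ} {τ : Equiv.Perm (Fin m)} {G : Fin m → ℝ → ℝ × ℝ}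
    (hG : StrandMotion τ G) (hs : ∀ k, ContDiff ℝ ∞ (G k)) (s : Fin 2 → Fin m) (a : Fin 2) :
    ContDiff ℝ ∞ (braidLoop τ s G a) := by
  rw [contDiff_iff_contDiffAt]
  intro x
  refine ContDiffAt.congr_of_eventuallyEq (f := fun y => G ((τ ^ (⌊x⌋ - 1)) (s a)) (y - ⌊x⌋ + 1) +
    G ((τ ^ ⌊x⌋) (s a)) (y - ⌊x⌋) - (((((τ ^ ⌊x⌋) (s a) : Fin m) : ℕ) : ℝ), 0)) ?_ ?_
  · have h1 : ContDiff ℝ ∞ (fun y : ℝ => y - ⌊x⌋) := contDiff_id.sub contDiff_const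
    exact ((((hs _).comp (h1.add contDiff_const)).add ((hs _).comp h1)).sub
      contDiff_const).contDiffAt
  · filter_upwards [isOpen_Ioo.mem_nhds (mem_Ioo_floor x)] with y hy
    exact braidLoop_eq_on_Ioo hG s a _ hy

theorem continuous_braidLoop_family {m : ℕ} {τ : Equiv.Perm (Fin m)}
    {G : ℝ → Fin m → ℝ → ℝ × ℝ} (hG : ∀ t, StrandMotion τ (G t))
    (hc : ∀ k, Continuous fun p : ℝ × ℝ => G p.1 k p.2) (s : Fin 2 → Fin m) (a : Fin 2) :
    Continuous fun p : ℝ × ℝ => braidLoop τ s (G p.1) a p.2 := by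
  rw [continuous_iff_continuousAt]
  rintro ⟨t, x⟩
  refine ContinuousAt.congr (f := fun p : ℝ × ℝ => G p.1 ((τ ^ (⌊x⌋ - 1)) (s a)) (p.2 - ⌊x⌋ + 1) +
    G p.1 ((τ ^ ⌊x⌋) (s a)) (p.2 - ⌊x⌋) - (((((τ ^ ⌊x⌋) (s a) : Fin m) : ℕ) : ℝ), 0)) ?_ ?_
  · have h1 : Continuous (fun p : ℝ × ℝ => p.2 - ⌊x⌋) := continuous_snd.sub continuous_const
    exact ((((hc _).comp (continuous_fst.prodMk (h1.add continuous_const))).add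
      ((hc _).comp (continuous_fst.prodMk h1))).sub continuous_const).continuousAt
  · filter_upwards [continuous_snd.continuousAt.preimage_mem_nhds
      (isOpen_Ioo.mem_nhds (mem_Ioo_floor x))] with p hp
    exact (braidLoop_eq_on_Ioo (hG p.1) s a _ hp).symm

theorem continuous_braidLoop {m : ℕ} {τ : Equiv.Perm (Fin m)} {G : Fin m → ℝ → ℝ × ℝ}
    (hG : StrandMotion τ G) (hc : ∀ k, Continuous (G k)) (s : Fin 2 → Fin m) (a : Fin 2) :
    Continuous (braidLoop τ s G a) :=
  (continuous_braidLoop_family (fun _ : ℝ => hG) (fun k => (hc k).comp continuous_snd) s a).comp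
    (continuous_const (y := (0 : ℝ)).prodMk continuous_id)

/-- The motion of strands along a path of configurations. -/
def pathMotion {m : ℕ} {a b : Conf m} (γ : Path a b) (k : Fin m) (x : ℝ) : ℝ × ℝ :=
  (γ (Set.projIcc 0 1 zero_le_one x)).1 k

theorem strandMotion_pathMotion {m : ℕ} {τ : Equiv.Perm (Fin m)}
    (γ : Path (gridConf 1) (gridConf τ)) : StrandMotion τ (pathMotion γ) := by
  refine ⟨fun k x hx => ?_, fun k x hx => ?_, fun x => (γ _).2.1, fun k x => (γ _).2.2 k⟩
  · rw [pathMotion, Set.projIcc_of_le_left _ hx]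
    exact congrFun (congrArg Subtype.val γ.source) k
  · rw [pathMotion, Set.projIcc_of_right_le _ hx]
    exact congrFun (congrArg Subtype.val γ.target) k

theorem continuous_pathMotion {m : ℕ} {a b : Conf m} (γ : Path a b) (k : Fin m) :
    Continuous (pathMotion γ k) :=
  (continuous_apply k).comp (continuous_subtype_val.comp (γ.continuous.comp continuous_projIcc))

theorem braidHomotopic_of_homotopic {m q : ℕ} {τ : Equiv.Perm (Fin m)} {s : Fin 2 → Fin m}
    (hs : OrbitsOfLength q τ s) {γ γ' : Path (gridConf (1 : Equiv.Perm (Fin m))) (gridConf τ)}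
    (h : γ.Homotopic γ') :
    BraidHomotopic q (braidLoop τ s (pathMotion γ)) (braidLoop τ s (pathMotion γ')) := by
  obtain ⟨F⟩ := h
  have hm : ∀ t : ℝ, StrandMotion τ (pathMotion (F.eval (Set.projIcc 0 1 zero_le_one t))) :=
    fun t => strandMotion_pathMotion _
  refine ⟨fun t => braidLoop τ s (pathMotion (F.eval (Set.projIcc 0 1 zero_le_one t))),
    continuous_braidLoop_family hm (fun k => ?_) s, fun t _ => (hm t).closedBraid hs, ?_, ?_⟩
  · exact (continuous_apply k).comp (continuous_subtype_val.comp (F.continuous.comp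
      ((continuous_projIcc.comp continuous_fst).prodMk (continuous_projIcc.comp continuous_snd))))
  · simp
  · simp

theorem pathMotion_trans {m : ℕ} {a b c : Conf m} (γ : Path a b) (η : Path b c) (k : Fin m)
    {x : ℝ} (hx : x ∈ Set.Icc (0 : ℝ) 1) : pathMotion (γ.trans η) k x =
      if x ≤ 1 / 2 then pathMotion γ k (2 * x) else pathMotion η k (2 * x - 1) := by
  rw [pathMotion, Set.projIcc_of_mem _ hx, Path.trans_apply]
  split_ifs with h
  · rw [pathMotion, Set.projIcc_of_mem _ ⟨by linarith [hx.1], by linarith⟩]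
  · rw [pathMotion, Set.projIcc_of_mem _ ⟨by linarith [hx.1], by linarith [hx.2]⟩]

/-- Starting half a period later exchanges the two factors of a product. The paths `γ'` and `η'` are
`γ` and `η` with the strands relabelled by what happened before. -/
theorem braidLoop_trans_shift {m : ℕ} {τ₁ τ₂ : Equiv.Perm (Fin m)}
    {γ : Path (gridConf 1) (gridConf τ₁)} {γ' : Path (gridConf τ₂) (gridConf (τ₁ * τ₂))}
    {η : Path (gridConf 1) (gridConf τ₂)} {η' : Path (gridConf τ₁) (gridConf (τ₂ * τ₁))}
    (hγ : ∀ k x, pathMotion γ' k x = pathMotion γ (τ₂ k) x)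
    (hη : ∀ k x, pathMotion η' k x = pathMotion η (τ₁ k) x) (s : Fin 2 → Fin m) (a : Fin 2)
    (x : ℝ) : braidLoop (τ₂ * τ₁) s (pathMotion (γ.trans η')) a (x + 1 / 2) =
      braidLoop (τ₁ * τ₂) (fun a => τ₁ (s a)) (pathMotion (η.trans γ')) a x := by
  have hsemi : SemiconjBy τ₁ (τ₂ * τ₁) (τ₁ * τ₂) := by
    simp [SemiconjBy, mul_assoc]
  have hz : ∀ n : ℤ, ((τ₁ * τ₂) ^ n) (τ₁ (s a)) = τ₁ (((τ₂ * τ₁) ^ n) (s a)) := fun n => by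
    rw [← Equiv.Perm.mul_apply, ← Equiv.Perm.mul_apply, (hsemi.zpow_right n).eq]
  have f0 := Int.fract_nonneg x
  have f1 := Int.fract_lt_one x
  have hfx := Int.floor_add_fract x
  rcases lt_or_ge (Int.fract x) (1 / 2) with h | h
  · have e1 : ⌊x + 1 / 2⌋ = ⌊x⌋ := by
      rw [Int.floor_eq_iff]; constructor <;> linarith
    have e2 : Int.fract (x + 1 / 2) = Int.fract x + 1 / 2 := by
      rw [Int.fract, e1]; linarith
    simp only [braidLoop, e1, e2]
    rw [pathMotion_trans _ _ _ ⟨by linarith, by linarith⟩,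
      pathMotion_trans _ _ _ ⟨by linarith, by linarith⟩, if_pos h.le, hz]
    split_ifs with h0
    -- Concatenation assigns its midpoint to the first half, so the two sides use different factors
    -- here; both give the same grid point.
    · have h0 : Int.fract x = 0 := by linarith
      rw [h0, (strandMotion_pathMotion γ).finish _ _ (by norm_num),
        (strandMotion_pathMotion η).start _ _ (by norm_num)]
    · rw [hη]; congr 1; ring
  · have e1 : ⌊x + 1 / 2⌋ = ⌊x⌋ + 1 := by
      rw [Int.floor_eq_iff]; push_cast; constructor <;> linarith
    have e2 : Int.fract (x + 1 / 2) = Int.fract x - 1 / 2 := by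
      rw [Int.fract, e1]; push_cast; linarith
    have hτ : ((τ₂ * τ₁) ^ (⌊x⌋ + 1)) (s a) = τ₂ (τ₁ (((τ₂ * τ₁) ^ ⌊x⌋) (s a))) := by
      rw [add_comm, zpow_one_add]; rfl
    simp only [braidLoop, e1, e2]
    rw [pathMotion_trans _ _ _ ⟨by linarith, by linarith⟩,
      pathMotion_trans _ _ _ ⟨by linarith, by linarith⟩, if_pos (by linarith), hz, hτ]
    split_ifs with h0
    · have h0 : Int.fract x = 1 / 2 := by linarith
      rw [h0, (strandMotion_pathMotion η).finish _ _ (by norm_num),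
        (strandMotion_pathMotion γ).start _ _ (by norm_num)]
    · rw [hγ]; congr 1; ring

/-! ### The motion of a braid word -/

/-- The lower of the two positions exchanged by the generator `i`. -/
def lowerPos {m : ℕ} (i : Fin (m - 1)) : Fin m := ⟨i, by omega⟩

/-- The upper of the two positions exchanged by the generator `i`. -/
def upperPos {m : ℕ} (i : Fin (m - 1)) : Fin m := ⟨i + 1, by omega⟩

theorem lowerPos_ne_upperPos {m : ℕ} (i : Fin (m - 1)) : lowerPos i ≠ upperPos i := by
  simp [lowerPos, upperPos]

/-- The permutation of positions of a letter. -/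
def letterSwap {m : ℕ} (l : Fin (m - 1) × Bool) : Equiv.Perm (Fin m) :=
  Equiv.swap (lowerPos l.1) (upperPos l.1)

/-- The permutation of positions of a word. -/
def wordPerm {m : ℕ} : BraidWord m → Equiv.Perm (Fin m)
  | [] => 1
  | l :: w => wordPerm w * letterSwap l

theorem strandPosition_lowerPos {m : ℕ} (i : Fin (m - 1)) (ε : Bool) (u : ℝ) :
    strandPosition (some (i, ε)) (lowerPos i) u =
      ((i : ℝ) + 1 / 2 - Real.cos (Real.pi * Real.smoothTransition u) / 2,
        (if ε then 1 else -1) * (Real.sin (Real.pi * Real.smoothTransition u) / 2)) := by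
  simp [strandPosition, lowerPos]

theorem strandPosition_upperPos {m : ℕ} (i : Fin (m - 1)) (ε : Bool) (u : ℝ) :
    strandPosition (some (i, ε)) (upperPos i) u =
      ((i : ℝ) + 1 / 2 + Real.cos (Real.pi * Real.smoothTransition u) / 2,
        -((if ε then 1 else -1) * (Real.sin (Real.pi * Real.smoothTransition u) / 2))) := by
  simp [strandPosition, upperPos]

theorem strandPosition_other {m : ℕ} (i : Fin (m - 1)) (ε : Bool) {k : Fin m}
    (h1 : k ≠ lowerPos i) (h2 : k ≠ upperPos i) (u : ℝ) :
    strandPosition (some (i, ε)) k u = ((k : ℝ), 0) := by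
  have h1' : (k : ℕ) ≠ i := fun h => h1 (Fin.ext h)
  have h2' : (k : ℕ) ≠ i + 1 := fun h => h2 (Fin.ext h)
  simp [strandPosition, h1', h2']

theorem pos_cases {m : ℕ} (i : Fin (m - 1)) (k : Fin m) :
    k = lowerPos i ∨ k = upperPos i ∨ (k ≠ lowerPos i ∧ k ≠ upperPos i) := by tauto

theorem strandPosition_start {m : ℕ} (l : Fin (m - 1) × Bool) (k : Fin m) {u : ℝ} (hu : u ≤ 0) :
    strandPosition (some l) k u = ((k : ℝ), 0) := by
  obtain ⟨i, ε⟩ := l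
  rcases pos_cases i k with rfl | rfl | ⟨h1, h2⟩
  · rw [strandPosition_lowerPos, Real.smoothTransition.zero_of_nonpos hu]
    simp [lowerPos]
  · rw [strandPosition_upperPos, Real.smoothTransition.zero_of_nonpos hu]
    simp [upperPos]; ring
  · exact strandPosition_other i ε h1 h2 u

theorem strandPosition_finish {m : ℕ} (l : Fin (m - 1) × Bool) (k : Fin m) {u : ℝ} (hu : 1 ≤ u) :
    strandPosition (some l) k u = (((letterSwap l k : Fin m) : ℝ), 0) := by
  obtain ⟨i, ε⟩ := l
  rcases pos_cases i k with rfl | rfl | ⟨h1, h2⟩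
  · rw [strandPosition_lowerPos, Real.smoothTransition.one_of_one_le hu, letterSwap,
      Equiv.swap_apply_left]
    simp [upperPos]; ring
  · rw [strandPosition_upperPos, Real.smoothTransition.one_of_one_le hu, letterSwap,
      Equiv.swap_apply_right]
    simp [lowerPos]; ring
  · rw [strandPosition_other i ε h1 h2 u, letterSwap, Equiv.swap_apply_of_ne_of_ne h1 h2]

theorem contDiff_strandPosition {m : ℕ} (l : Fin (m - 1) × Bool) (k : Fin m) :
    ContDiff ℝ ∞ (strandPosition (some l) k) := by
  obtain ⟨i, ε⟩ := l
  have h : ContDiff ℝ ∞ (fun u => Real.pi * Real.smoothTransition u) :=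
    contDiff_const.mul Real.smoothTransition.contDiff
  rcases pos_cases i k with rfl | rfl | ⟨h1, h2⟩
  · rw [funext (strandPosition_lowerPos i ε)]
    exact (contDiff_const.sub ((Real.contDiff_cos.comp h).div_const _)).prodMk
      (contDiff_const.mul ((Real.contDiff_sin.comp h).div_const _))
  · rw [funext (strandPosition_upperPos i ε)]
    exact (contDiff_const.add ((Real.contDiff_cos.comp h).div_const _)).prodMk
      (contDiff_const.mul ((Real.contDiff_sin.comp h).div_const _)).neg
  · rw [funext (strandPosition_other i ε h1 h2)]
    exact contDiff_const

theorem strandPosition_fst_nonneg {m : ℕ} (l : Fin (m - 1) × Bool) (k : Fin m) (u : ℝ) :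
    0 ≤ (strandPosition (some l) k u).1 := by
  obtain ⟨i, ε⟩ := l
  have h0 : (0 : ℝ) ≤ (i : ℕ) := Nat.cast_nonneg _
  have h1 := Real.neg_one_le_cos (Real.pi * Real.smoothTransition u)
  have h2 := Real.cos_le_one (Real.pi * Real.smoothTransition u)
  rcases pos_cases i k with rfl | rfl | ⟨h1, h2⟩
  · rw [strandPosition_lowerPos]; simp only; linarith
  · rw [strandPosition_upperPos]; simp only; linarith
  · rw [strandPosition_other i ε h1 h2 u]; exact Nat.cast_nonneg _

/-- If `h` compares the two positions exchanged by the letter as the letter does, then points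
with the same first coordinate are ordered by `h` during the motion of the letter. -/
def LetterLayered {m : ℕ} (h : Fin m → ℝ) (l : Fin (m - 1) × Bool) : Prop :=
  if l.2 then h (upperPos l.1) < h (lowerPos l.1) else h (lowerPos l.1) < h (upperPos l.1)

/-- The two exchanged points stay over [i, i + 1] and the others rest at integers outside it. Hence
first coordinates agree only for the exchanged pair at the middle of the half-turn, where the cosine
is 0 and the sine is 1. -/
theorem LetterLayered.strandPosition {m : ℕ} {h : Fin m → ℝ} {l : Fin (m - 1) × Bool}
    (hl : LetterLayered h l) {k k' : Fin m} (hk : k ≠ k') {u : ℝ}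
    (hu : (strandPosition (some l) k u).1 = (strandPosition (some l) k' u).1) :
    0 < ((strandPosition (some l) k u).2 - (strandPosition (some l) k' u).2) * (h k - h k') := by
  obtain ⟨i, ε⟩ := l
  have s0 := Real.smoothTransition.nonneg u
  have s1 := Real.smoothTransition.le_one u
  have hpi := Real.pi_pos
  have hsin : 0 ≤ Real.sin (Real.pi * Real.smoothTransition u) :=
    Real.sin_nonneg_of_nonneg_of_le_pi (by positivity) (by nlinarith)
  have hsc := Real.sin_sq_add_cos_sq (Real.pi * Real.smoothTransition u)
  have hcos1 := Real.neg_one_le_cos (Real.pi * Real.smoothTransition u)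
  have hcos2 := Real.cos_le_one (Real.pi * Real.smoothTransition u)
  have key : Real.cos (Real.pi * Real.smoothTransition u) = 0 →
      Real.sin (Real.pi * Real.smoothTransition u) = 1 := by
    intro h0
    rw [h0] at hsc
    nlinarith
  have other : ∀ k : Fin m, k ≠ lowerPos i → k ≠ upperPos i →
      ((k : ℕ) : ℝ) + 1 ≤ (i : ℕ) ∨ ((i : ℕ) : ℝ) + 2 ≤ (k : ℕ) := by
    intro k h1 h2
    have h1' : (k : ℕ) ≠ i := fun h => h1 (Fin.ext h)
    have h2' : (k : ℕ) ≠ i + 1 := fun h => h2 (Fin.ext h)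
    rcases (by omega : (k : ℕ) + 1 ≤ i ∨ (i : ℕ) + 2 ≤ k) with h | h
    · left; exact_mod_cast h
    · right; exact_mod_cast h
  rcases pos_cases i k with rfl | rfl | ⟨h1, h2⟩ <;>
    rcases pos_cases i k' with rfl | rfl | ⟨h1', h2'⟩
  · exact absurd rfl hk
  · rw [strandPosition_lowerPos, strandPosition_upperPos] at hu ⊢
    simp only at hu ⊢
    have hs := key (by linarith)
    rw [hs]
    cases ε
    · simp only [LetterLayered, Bool.false_eq_true, if_false] at hl ⊢; linarith
    · simp only [LetterLayered, if_true] at hl ⊢; linarith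
  · rw [strandPosition_lowerPos, strandPosition_other i ε h1' h2' u] at hu
    simp only at hu
    rcases other k' h1' h2' with h | h <;> linarith
  · rw [strandPosition_lowerPos, strandPosition_upperPos] at hu ⊢
    simp only at hu ⊢
    have hs := key (by linarith)
    rw [hs]
    cases ε
    · simp only [LetterLayered, Bool.false_eq_true, if_false] at hl ⊢; linarith
    · simp only [LetterLayered, if_true] at hl ⊢; linarith
  · exact absurd rfl hk
  · rw [strandPosition_upperPos, strandPosition_other i ε h1' h2' u] at hu
    simp only at hu
    rcases other k' h1' h2' with h | h <;> linarith
  · rw [strandPosition_lowerPos, strandPosition_other i ε h1 h2 u] at hu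
    simp only at hu
    rcases other k h1 h2 with h | h <;> linarith
  · rw [strandPosition_upperPos, strandPosition_other i ε h1 h2 u] at hu
    simp only at hu
    rcases other k h1 h2 with h | h <;> linarith
  · rw [strandPosition_other i ε h1 h2 u, strandPosition_other i ε h1' h2' u] at hu
    simp only at hu
    exact absurd (Fin.ext (by exact_mod_cast hu)) hk

theorem exists_letterLayered {m : ℕ} (l : Fin (m - 1) × Bool) :
    ∃ h : Fin m → ℝ, LetterLayered h l := by
  obtain ⟨i, ε⟩ := l
  cases ε
  · exact ⟨fun k => (k : ℕ), by simp [LetterLayered, lowerPos, upperPos]⟩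
  · exact ⟨fun k => -(k : ℕ), by simp [LetterLayered, lowerPos, upperPos]⟩

/-- For heights adapted to the letter, a collision would contradict the strict inequality of
layering. -/
theorem strandPosition_injective {m : ℕ} (l : Fin (m - 1) × Bool) (u : ℝ) :
    Function.Injective fun k => strandPosition (some l) k u := by
  intro k k' hk
  by_contra hne
  obtain ⟨h, hl⟩ := exists_letterLayered l
  have := hl.strandPosition hne (congrArg Prod.fst hk)
  simp only at hk
  simp [hk] at this

/-- The motion of the strands in a braid word, one unit of time for each letter. -/
def wordMotion {m : ℕ} : BraidWord m → Fin m → ℝ → ℝ × ℝ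
  | [] => fun k _ => ((k : ℝ), 0)
  | l :: w => fun k x => strandPosition (some l) k x + wordMotion w (letterSwap l k) (x - 1) -
      (((letterSwap l k : Fin m) : ℝ), 0)

theorem wordMotion_cons {m : ℕ} (l : Fin (m - 1) × Bool) (w : BraidWord m) (k : Fin m) (x : ℝ) :
    wordMotion (l :: w) k x = strandPosition (some l) k x +
      wordMotion w (letterSwap l k) (x - 1) - (((letterSwap l k : Fin m) : ℝ), 0) := rfl

theorem wordMotion_start {m : ℕ} (w : BraidWord m) (k : Fin m) {x : ℝ} (hx : x ≤ 0) :
    wordMotion w k x = ((k : ℝ), 0) := by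
  induction w generalizing k x with
  | nil => rfl
  | cons l w ih => rw [wordMotion_cons, ih _ (by linarith), strandPosition_start l k hx,
      add_sub_cancel_right]

theorem wordMotion_cons_of_le {m : ℕ} (l : Fin (m - 1) × Bool) (w : BraidWord m) (k : Fin m)
    {x : ℝ} (hx : x ≤ 1) : wordMotion (l :: w) k x = strandPosition (some l) k x := by
  rw [wordMotion_cons, wordMotion_start _ _ (by linarith), add_sub_cancel_right]

theorem wordMotion_cons_of_ge {m : ℕ} (l : Fin (m - 1) × Bool) (w : BraidWord m) (k : Fin m)
    {x : ℝ} (hx : 1 ≤ x) : wordMotion (l :: w) k x = wordMotion w (letterSwap l k) (x - 1) := by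
  rw [wordMotion_cons, strandPosition_finish l k hx, add_sub_cancel_left]

theorem wordMotion_finish {m : ℕ} (w : BraidWord m) (k : Fin m) {x : ℝ} (hx : w.length ≤ x) :
    wordMotion w k x = (((wordPerm w k : Fin m) : ℝ), 0) := by
  induction w generalizing k x with
  | nil => rfl
  | cons l w ih =>
    simp only [List.length_cons, Nat.cast_add, Nat.cast_one] at hx
    have : (0 : ℝ) ≤ w.length := Nat.cast_nonneg _
    rw [wordMotion_cons_of_ge _ _ _ (by linarith), ih _ (by linarith)]
    rfl

theorem contDiff_wordMotion {m : ℕ} (w : BraidWord m) (k : Fin m) :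
    ContDiff ℝ ∞ (wordMotion w k) := by
  induction w generalizing k with
  | nil => exact contDiff_const
  | cons l w ih =>
    exact ((contDiff_strandPosition l k).add
      ((ih (letterSwap l k)).comp (contDiff_id.sub contDiff_const))).sub contDiff_const

theorem wordMotion_injective {m : ℕ} (w : BraidWord m) (x : ℝ) :
    Function.Injective fun k => wordMotion w k x := by
  induction w generalizing x with
  | nil =>
    intro k k' h
    have h1 : ((k : ℕ) : ℝ) = (k' : ℕ) := congrArg Prod.fst h
    exact Fin.ext (by exact_mod_cast h1)
  | cons l w ih =>
    rcases le_total x 1 with hx | hx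
    · simp only [wordMotion_cons_of_le _ _ _ hx]
      exact strandPosition_injective l x
    · simp only [wordMotion_cons_of_ge _ _ _ hx]
      exact (ih (x - 1)).comp (letterSwap l).injective

theorem wordMotion_fst_nonneg {m : ℕ} (w : BraidWord m) (k : Fin m) (x : ℝ) :
    0 ≤ (wordMotion w k x).1 := by
  induction w generalizing k x with
  | nil => exact Nat.cast_nonneg _
  | cons l w ih =>
    rcases le_total x 1 with hx | hx
    · rw [wordMotion_cons_of_le _ _ _ hx]
      exact strandPosition_fst_nonneg l k x
    · rw [wordMotion_cons_of_ge _ _ _ hx]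
      exact ih _ _

/-- The word is layered with respect to heights `h` given to the positions at its start. -/
def WordLayered {m : ℕ} : (Fin m → ℝ) → BraidWord m → Prop
  | _, [] => True
  | h, l :: w => LetterLayered h l ∧ WordLayered (fun k => h (letterSwap l k)) w

theorem WordLayered.wordMotion {m : ℕ} {h : Fin m → ℝ} {w : BraidWord m} (hw : WordLayered h w)
    {k k' : Fin m} (hk : k ≠ k') {x : ℝ}
    (hx : (wordMotion w k x).1 = (wordMotion w k' x).1) :
    0 < ((wordMotion w k x).2 - (wordMotion w k' x).2) * (h k - h k') := by
  induction w generalizing h k k' x with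
  | nil =>
    have h1 : ((k : ℕ) : ℝ) = (k' : ℕ) := hx
    exact absurd (Fin.ext (by exact_mod_cast h1)) hk
  | cons l w ih =>
    rcases le_total x 1 with h1 | h1
    · simp only [wordMotion_cons_of_le _ _ _ h1] at hx ⊢
      exact hw.1.strandPosition hk hx
    · simp only [wordMotion_cons_of_ge _ _ _ h1] at hx ⊢
      have := ih hw.2 ((letterSwap l).injective.ne hk) hx
      -- The tail is layered for heights carried along by the swap; as the swap is an involution,
      -- each strand gets back its original height.
      have e : ∀ k, letterSwap l (letterSwap l k) = k := fun k => by
        simp [letterSwap]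
      simpa only [e] using this

/-- The path of configurations of a braid word, starting at the labelling `σ` of the positions. -/
def wordPath {m : ℕ} (w : BraidWord m) (σ : Equiv.Perm (Fin m)) :
    Path (gridConf σ) (gridConf (wordPerm w * σ)) where
  toFun u := ⟨fun k => wordMotion w (σ k) ((w.length + 1) * u),
    (wordMotion_injective w _).comp σ.injective,
    fun k => by linarith [wordMotion_fst_nonneg w (σ k) ((w.length + 1) * u)]⟩
  continuous_toFun := Continuous.subtype_mk (continuous_pi fun k =>
    (contDiff_wordMotion w (σ k)).continuous.comp (by fun_prop)) _
  source' := Subtype.ext (funext fun k => wordMotion_start w _ (by simp))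
  target' := Subtype.ext (funext fun k => wordMotion_finish w _ (by simp))

/-- The path of configurations of a letter. -/
def letterPath {m : ℕ} (l : Fin (m - 1) × Bool) (σ : Equiv.Perm (Fin m)) :
    Path (gridConf σ) (gridConf (letterSwap l * σ)) where
  toFun u := ⟨fun k => strandPosition (some l) (σ k) u,
    (strandPosition_injective l _).comp σ.injective,
    fun k => by linarith [strandPosition_fst_nonneg l (σ k) u]⟩
  continuous_toFun := Continuous.subtype_mk (continuous_pi fun k =>
    (contDiff_strandPosition l (σ k)).continuous.comp (by fun_prop)) _
  source' := Subtype.ext (funext fun k => strandPosition_start l _ (by simp))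
  target' := Subtype.ext (funext fun k => strandPosition_finish l _ (by simp))

theorem wordPath_nil {m : ℕ} (σ : Equiv.Perm (Fin m)) :
    (wordPath [] σ).Homotopic ((Path.refl (gridConf σ)).cast rfl (by rw [wordPerm, one_mul])) := by
  have : wordPath [] σ = (Path.refl (gridConf σ)).cast rfl (by rw [wordPerm, one_mul]) := by
    ext1
    funext u
    rfl
  rw [this]

/-- The two paths differ only in speed: the word gives its first letter the fraction 1/(N + 2) of
the time, where N is the length of `w`, and the concatenation gives it one half. -/
theorem wordPath_cons {m : ℕ} (l : Fin (m - 1) × Bool) (w : BraidWord m)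
    (σ : Equiv.Perm (Fin m)) : (wordPath (l :: w) σ).Homotopic
      (((letterPath l σ).trans (wordPath w (letterSwap l * σ))).cast rfl
        (by rw [wordPerm, mul_assoc])) := by
  have hN : (0 : ℝ) ≤ w.length := Nat.cast_nonneg _
  -- The piecewise linear change of time is concave with its corner at x = 1/(N + 2), so it is the
  -- minimum of its two linear branches.
  let f : unitInterval → unitInterval := fun x => Set.projIcc 0 1 zero_le_one
    (min ((w.length + 2) * x / 2) (1 / 2 + ((w.length + 2) * x - 1) / (2 * (w.length + 1))))
  have hfc : Continuous f := continuous_projIcc.comp (by fun_prop)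
  have f0 : f 0 = 0 := by
    apply Set.projIcc_of_le_left
    exact (min_le_left _ _).trans (by simp)
  have f1 : f 1 = 1 := by
    apply Set.projIcc_of_right_le
    refine le_min (by rw [Set.Icc.coe_one]; linarith) ?_
    have : (((w.length : ℝ) + 2) * ((1 : unitInterval) : ℝ) - 1) / (2 * (w.length + 1)) = 1 / 2 := by
      rw [Set.Icc.coe_one]; field_simp; ring
    rw [this]; norm_num
  have e : wordPath (l :: w) σ = (((letterPath l σ).trans (wordPath w (letterSwap l * σ))).cast rfl
        (by rw [wordPerm, mul_assoc])).reparam f hfc f0 f1 := by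
    ext1
    funext u
    apply Subtype.ext
    funext k
    have u0 := u.2.1
    have u1 := u.2.2
    have hdiff : 1 / 2 + (((w.length : ℝ) + 2) * u - 1) / (2 * (w.length + 1)) =
        (w.length + 2) * u / 2 - ((w.length + 2) * u - 1) * w.length / (2 * (w.length + 1)) := by
      field_simp; ring
    show wordMotion (l :: w) (σ k) (((l :: w).length + 1) * u) =
      (((letterPath l σ).trans (wordPath w (letterSwap l * σ))) (f u)).1 k
    have hlen : (((l :: w).length : ℝ) + 1) * u = (w.length + 2) * u := by
      push_cast [List.length_cons]; ring
    rw [Path.trans_apply, hlen]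
    rcases le_or_gt (((w.length : ℝ) + 2) * u) 1 with h | h
    · have hm : min (((w.length : ℝ) + 2) * u / 2)
          (1 / 2 + ((w.length + 2) * u - 1) / (2 * (w.length + 1))) = (w.length + 2) * u / 2 := by
        apply min_eq_left
        rw [hdiff]
        have : (((w.length : ℝ) + 2) * u - 1) * w.length / (2 * (w.length + 1)) ≤ 0 :=
          div_nonpos_of_nonpos_of_nonneg (mul_nonpos_of_nonpos_of_nonneg (by linarith) hN)
            (by positivity)
        linarith
      have hfu : ((f u : unitInterval) : ℝ) = (w.length + 2) * u / 2 := by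
        simp only [f, hm]
        rw [Set.projIcc_of_mem _ ⟨by positivity, by linarith⟩]
      rw [dif_pos (by rw [hfu]; linarith), wordMotion_cons_of_le _ _ _ h]
      show _ = strandPosition (some l) (σ k) (2 * (f u : ℝ))
      rw [hfu]; congr 1; ring
    · have hm : min (((w.length : ℝ) + 2) * u / 2)
          (1 / 2 + ((w.length + 2) * u - 1) / (2 * (w.length + 1))) =
            1 / 2 + ((w.length + 2) * u - 1) / (2 * (w.length + 1)) := by
        apply min_eq_right
        rw [hdiff]
        have : 0 ≤ (((w.length : ℝ) + 2) * u - 1) * w.length / (2 * (w.length + 1)) :=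
          div_nonneg (mul_nonneg (by linarith) hN) (by positivity)
        linarith
      have hpos : 0 < (((w.length : ℝ) + 2) * u - 1) / (2 * (w.length + 1)) :=
        div_pos (by linarith) (by positivity)
      have hfu : ((f u : unitInterval) : ℝ) =
          1 / 2 + ((w.length + 2) * u - 1) / (2 * (w.length + 1)) := by
        simp only [f, hm]
        rw [Set.projIcc_of_mem _ ⟨by linarith, ?_⟩]
        have : (((w.length : ℝ) + 2) * u - 1) / (2 * (w.length + 1)) ≤ 1 / 2 := by
          rw [div_le_iff₀ (by positivity)]
          nlinarith
        linarith
      rw [dif_neg (by rw [hfu]; linarith), wordMotion_cons_of_ge _ _ _ h.le]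
      show _ = wordMotion w (letterSwap l (σ k)) ((w.length + 1) * (2 * (f u : ℝ) - 1))
      rw [hfu]; congr 1; field_simp; ring
  rw [e]
  exact ⟨(Path.Homotopy.reparam _ f hfc f0 f1).symm⟩

/-! ### Homotopy classes of braid words -/

/-- Motions up to homotopy: to each labelling of the positions a homotopy class of paths to
another labelling. -/
def MotionMonoid (m : ℕ) :=
  ∀ σ : Equiv.Perm (Fin m), Σ τ : Equiv.Perm (Fin m),
    Path.Homotopic.Quotient (gridConf σ) (gridConf τ)

/-- Because the final labelling is stored with the homotopy class, composition is total. The braid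
relations can then be used as identities in a monoid, with no matching of endpoints. -/
instance (m : ℕ) : Monoid (MotionMonoid m) where
  one := fun σ => ⟨σ, Path.Homotopic.Quotient.refl _⟩
  mul F G := fun σ => ⟨(G (F σ).1).1, (F σ).2.trans (G (F σ).1).2⟩
  mul_assoc F G H := funext fun σ => Sigma.ext rfl (heq_of_eq
    (Path.Homotopic.Quotient.trans_assoc _ _ _))
  one_mul F := funext fun σ => Sigma.ext rfl (heq_of_eq (Path.Homotopic.Quotient.refl_trans _))
  mul_one F := funext fun σ => Sigma.ext rfl (heq_of_eq (Path.Homotopic.Quotient.trans_refl _))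

theorem MotionMonoid.one_apply {m : ℕ} (σ : Equiv.Perm (Fin m)) :
    (1 : MotionMonoid m) σ = ⟨σ, Path.Homotopic.Quotient.refl _⟩ := rfl

theorem MotionMonoid.mul_apply {m : ℕ} (F G : MotionMonoid m) (σ : Equiv.Perm (Fin m)) :
    (F * G) σ = ⟨(G (F σ).1).1, (F σ).2.trans (G (F σ).1).2⟩ := rfl

/-- The class of a letter. -/
def letterClass {m : ℕ} (l : Fin (m - 1) × Bool) : MotionMonoid m :=
  fun σ => ⟨letterSwap l * σ, Path.Homotopic.Quotient.mk (letterPath l σ)⟩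

/-- The class of a word. -/
def wordClass {m : ℕ} (w : BraidWord m) : MotionMonoid m := (w.map letterClass).prod

theorem wordClass_nil {m : ℕ} : wordClass ([] : BraidWord m) = 1 := rfl

theorem wordClass_cons {m : ℕ} (l : Fin (m - 1) × Bool) (w : BraidWord m) :
    wordClass (l :: w) = letterClass l * wordClass w := by
  simp [wordClass]

theorem wordClass_append {m : ℕ} (w w' : BraidWord m) :
    wordClass (w ++ w') = wordClass w * wordClass w' := by
  simp [wordClass]

theorem wordClass_power {m : ℕ} (w : BraidWord m) (k : ℕ) :
    wordClass (w.power k) = wordClass w ^ k := by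
  induction k with
  | zero => rfl
  | succ k ih =>
    have : w.power (k + 1) = w ++ w.power k := by simp [BraidWord.power, List.replicate_succ]
    rw [this, wordClass_append, ih, pow_succ']

theorem pathClass_eq_iff {m : ℕ} {σ τ τ' : Equiv.Perm (Fin m)} (hτ : τ = τ')
    (γ : Path (gridConf σ) (gridConf τ)) (γ' : Path (gridConf σ) (gridConf τ')) :
    ((⟨τ, Path.Homotopic.Quotient.mk γ⟩ :
      Σ τ : Equiv.Perm (Fin m), Path.Homotopic.Quotient (gridConf σ) (gridConf τ)) =
      ⟨τ', Path.Homotopic.Quotient.mk γ'⟩) ↔ γ.Homotopic (γ'.cast rfl (by rw [hτ])) := by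
  subst hτ
  constructor
  · intro h
    have := eq_of_heq (Sigma.mk.inj h).2
    exact Path.Homotopic.Quotient.eq.1 this
  · intro h
    congr 1
    exact Path.Homotopic.Quotient.eq.2 h

theorem wordClass_apply {m : ℕ} (w : BraidWord m) (σ : Equiv.Perm (Fin m)) :
    wordClass w σ = ⟨wordPerm w * σ, Path.Homotopic.Quotient.mk (wordPath w σ)⟩ := by
  induction w generalizing σ with
  | nil =>
    rw [wordClass_nil, MotionMonoid.one_apply, ← Path.Homotopic.Quotient.mk_refl]
    refine ((pathClass_eq_iff (by rw [wordPerm, one_mul]) _ _).2 (wordPath_nil σ)).symm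
  | cons l w ih =>
    rw [wordClass_cons, MotionMonoid.mul_apply, ih]
    exact ((pathClass_eq_iff (by rw [wordPerm, mul_assoc]) _ _).2 (wordPath_cons l w σ)).symm

theorem WordLayered.layeredPath {m : ℕ} {h : Fin m → ℝ} {w : BraidWord m} (hw : WordLayered h w)
    (σ : Equiv.Perm (Fin m)) : LayeredPath (fun k => h (σ k)) (wordPath w σ) :=
  fun _ _ _ hkl hx => hw.wordMotion (σ.injective.ne hkl) hx

/-- The common source of the cancellation, commutation and braid relations: both sides of each are
layered for the same heights and induce the same permutation. -/
theorem WordLayered.wordClass_eq {m : ℕ} {h : Fin m → ℝ} (hh : Function.Injective h)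
    {w w' : BraidWord m} (hw : WordLayered h w) (hw' : WordLayered h w')
    (hp : wordPerm w = wordPerm w') : wordClass w = wordClass w' := by
  funext σ
  rw [wordClass_apply, wordClass_apply, pathClass_eq_iff (by rw [hp])]
  exact (hw.layeredPath σ).homotopic (h := fun k => h (σ k)) (hh.comp σ.injective)
    (hw'.layeredPath σ) (fun _ => rfl) (fun _ => rfl)

theorem neg_cast_injective (m : ℕ) : Function.Injective fun k : Fin m => -((k : ℕ) : ℝ) :=
  fun k l h => Fin.ext (by exact_mod_cast neg_injective h)

theorem cast_injective (m : ℕ) : Function.Injective fun k : Fin m => ((k : ℕ) : ℝ) :=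
  fun _ _ h => Fin.ext (Nat.cast_injective h)

/-! ### Group relations between letters -/

theorem letterClass_mul_inverse {m : ℕ} (i : Fin (m - 1)) :
    letterClass (i, true) * letterClass (i, false) = 1 := by
  have := WordLayered.wordClass_eq (neg_cast_injective m) (w := [(i, true), (i, false)]) (w' := [])
    (by simp [WordLayered, LetterLayered, letterSwap, lowerPos, upperPos]) trivial
    (by simp [wordPerm, letterSwap])
  simpa [wordClass] using this

theorem letterClass_inverse_mul {m : ℕ} (i : Fin (m - 1)) :
    letterClass (i, false) * letterClass (i, true) = 1 := by
  have := WordLayered.wordClass_eq (cast_injective m) (w := [(i, false), (i, true)]) (w' := [])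
    (by simp [WordLayered, LetterLayered, letterSwap, lowerPos, upperPos]) trivial
    (by simp [wordPerm, letterSwap])
  simpa [wordClass] using this

theorem letterClass_comm {m : ℕ} {i j : Fin (m - 1)} (hij : (i : ℕ) + 1 < j) :
    letterClass (i, true) * letterClass (j, true) =
      letterClass (j, true) * letterClass (i, true) := by
  have n1 : lowerPos i ≠ lowerPos j := by simp [lowerPos]; omega
  have n2 : lowerPos i ≠ upperPos j := by simp [lowerPos, upperPos]; omega
  have n3 : upperPos i ≠ lowerPos j := by simp [lowerPos, upperPos]; omega
  have n4 : upperPos i ≠ upperPos j := by simp [upperPos]; omega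
  have := WordLayered.wordClass_eq (neg_cast_injective m) (w := [(i, true), (j, true)])
    (w' := [(j, true), (i, true)])
    (by simp [WordLayered, LetterLayered, letterSwap, Equiv.swap_apply_of_ne_of_ne, n1.symm,
          n2.symm, n3.symm, n4.symm]; simp [lowerPos, upperPos])
    (by simp [WordLayered, LetterLayered, letterSwap, Equiv.swap_apply_of_ne_of_ne, n1,
          n2, n3, n4]; simp [lowerPos, upperPos])
    (by
      simp only [wordPerm, letterSwap, one_mul]
      exact (Equiv.Perm.disjoint_swap_swap (by simp [lowerPos_ne_upperPos, n1, n2, n3, n4])).commute.symm)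
  simpa [wordClass] using this

/-- On either side each of the three pairs of strands crosses exactly once, and the one that starts
further left passes above. Heights decreasing with the position therefore fit both words. -/
theorem letterClass_braid {m : ℕ} {i j : Fin (m - 1)} (hij : (i : ℕ) + 1 = j) :
    letterClass (i, true) * letterClass (j, true) * letterClass (i, true) =
      letterClass (j, true) * letterClass (i, true) * letterClass (j, true) := by
  have e : lowerPos j = upperPos i := by simp [lowerPos, upperPos, hij]
  have n1 : lowerPos i ≠ upperPos i := lowerPos_ne_upperPos i
  have n2 : lowerPos i ≠ upperPos j := by simp [lowerPos, upperPos]; omega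
  have n3 : upperPos i ≠ upperPos j := by simp [upperPos]; omega
  have := WordLayered.wordClass_eq (neg_cast_injective m) (w := [(i, true), (j, true), (i, true)])
    (w' := [(j, true), (i, true), (j, true)])
    (by simp [WordLayered, LetterLayered, letterSwap, e, Equiv.swap_apply_of_ne_of_ne, n1, n2,
          n2.symm, n3.symm]; simp [lowerPos, upperPos]; omega)
    (by simp [WordLayered, LetterLayered, letterSwap, e, Equiv.swap_apply_of_ne_of_ne, n1, n2,
          n2.symm, n3.symm]; simp [lowerPos, upperPos]; omega)
    (by
      simp only [wordPerm, letterSwap, one_mul, e]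
      have h1 := Equiv.swap_mul_swap_mul_swap n3.symm n2.symm
      have h2 := Equiv.swap_mul_swap_mul_swap n1 n2
      rw [Equiv.swap_comm (upperPos i) (lowerPos i), Equiv.swap_comm (upperPos j)] at h1
      rw [h1, h2, Equiv.swap_comm])
  simpa [wordClass, mul_assoc] using this

/-! ### Powers of the torus braid -/

section BraidRelations

variable {M : Type*} [Monoid M] {S : ℕ → M} {N : ℕ}

/-- The product `S 0 * S 1 * ⋯ * S (k - 1)`. -/
def ascendingProd (S : ℕ → M) (k : ℕ) : M := ((List.range k).map S).prod

/-- The product `S (c + k - 1) * ⋯ * S (c + 1) * S c`. -/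
def descendingProd (S : ℕ → M) (c : ℕ) : ℕ → M
  | 0 => 1
  | k + 1 => S (c + k) * descendingProd S c k

theorem ascendingProd_succ (S : ℕ → M) (k : ℕ) :
    ascendingProd S (k + 1) = ascendingProd S k * S k := by
  simp [ascendingProd, List.range_succ]

theorem commute_ascendingProd (hc : ∀ i j, i + 1 < j → j < N → S i * S j = S j * S i) {j : ℕ}
    (hj : j < N) {k : ℕ} (hk : k < j) : S j * ascendingProd S k = ascendingProd S k * S j := by
  induction k with
  | zero => simp [ascendingProd]
  | succ k ih =>
    rw [ascendingProd_succ, ← mul_assoc, ih (by omega), mul_assoc, mul_assoc, hc k j hk hj]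

/-- Conjugation by an ascending product shifts generators by one. Trailing factors of large index
commute away until the product ends in S i * S (i + 1), where the braid relation applies. -/
theorem mul_ascendingProd (hb : ∀ i, i + 1 < N → S i * S (i + 1) * S i = S (i + 1) * S i * S (i + 1))
    (hc : ∀ i j, i + 1 < j → j < N → S i * S j = S j * S i) {i k : ℕ} (hi : i + 1 < k)
    (hk : k ≤ N) : S (i + 1) * ascendingProd S k = ascendingProd S k * S i := by
  induction k with
  | zero => omega
  | succ k ih =>
    rw [ascendingProd_succ]
    rcases Nat.lt_or_ge (i + 1) k with h | h
    · rw [← mul_assoc, ih h (by omega), mul_assoc, mul_assoc, hc i k h (by omega)]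
    · obtain rfl : k = i + 1 := by omega
      rw [ascendingProd_succ, ← mul_assoc, ← mul_assoc, commute_ascendingProd hc (by omega)
        (by omega), mul_assoc, mul_assoc, mul_assoc, mul_assoc, ← mul_assoc (S (i + 1)),
        ← hb i (by omega), mul_assoc]

theorem descendingProd_mul_ascendingProd
    (hb : ∀ i, i + 1 < N → S i * S (i + 1) * S i = S (i + 1) * S i * S (i + 1))
    (hc : ∀ i j, i + 1 < j → j < N → S i * S j = S j * S i) {c k K : ℕ} (h : c + 1 + k ≤ K)
    (hK : K ≤ N) : descendingProd S (c + 1) k * ascendingProd S K =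
      ascendingProd S K * descendingProd S c k := by
  induction k with
  | zero => simp [descendingProd]
  | succ k ih =>
    rw [descendingProd, descendingProd, mul_assoc, ih (by omega), ← mul_assoc, ← mul_assoc,
      show c + 1 + k = (c + k) + 1 by ring, mul_ascendingProd hb hc (by omega) hK]

/-- Each new factor A' = A * S (c + k), with A the product one generator shorter, is pulled to the
left through the descending run. This lowers the run by one index, and the freed S (c + k) becomes
its new first letter. -/
theorem ascendingProd_pow
    (hb : ∀ i, i + 1 < N → S i * S (i + 1) * S i = S (i + 1) * S i * S (i + 1))
    (hc : ∀ i j, i + 1 < j → j < N → S i * S j = S j * S i) {c k : ℕ} (hK : c + k + 1 ≤ N) :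
    ascendingProd S (c + k + 1) ^ k = ascendingProd S (c + k) ^ k * descendingProd S (c + 1) k := by
  have main : ∀ j ≤ k, ascendingProd S (c + k + 1) ^ j =
      ascendingProd S (c + k) ^ j * descendingProd S (c + k + 1 - j) j := by
    intro j
    induction j with
    | zero => simp [descendingProd]
    | succ j ih =>
      intro hj
      obtain ⟨d, hd⟩ : ∃ d, c + k + 1 - j = d + 1 := ⟨c + k - j, by omega⟩
      rw [pow_succ, ih (by omega), hd, mul_assoc, descendingProd_mul_ascendingProd hb hc
        (by omega) hK, ascendingProd_succ, pow_succ, show c + k + 1 - (j + 1) = d by omega,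
        descendingProd, show d + j = c + k by omega]
      simp only [mul_assoc]
  have := main k le_rfl
  rwa [show c + k + 1 - k = c + 1 by omega] at this

end BraidRelations

/-! ### Words for ascending and descending products -/

/-- The class of the `i`-th generator or of its inverse, and `1` if there is no such generator. -/
def genClass (m : ℕ) (ε : Bool) (i : ℕ) : MotionMonoid m :=
  if h : i < m - 1 then letterClass (⟨i, h⟩, ε) else 1

theorem genClass_of_lt {m i : ℕ} (ε : Bool) (h : i < m - 1) :
    genClass m ε i = letterClass (⟨i, h⟩, ε) := dif_pos h

theorem genClass_braid {m i : ℕ} (h : i + 1 < m - 1) :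
    genClass m true i * genClass m true (i + 1) * genClass m true i =
      genClass m true (i + 1) * genClass m true i * genClass m true (i + 1) := by
  rw [genClass_of_lt _ h, genClass_of_lt _ (by omega : i < m - 1)]
  exact letterClass_braid rfl

theorem genClass_comm {m i j : ℕ} (hij : i + 1 < j) (h : j < m - 1) :
    genClass m true i * genClass m true j = genClass m true j * genClass m true i := by
  rw [genClass_of_lt _ h, genClass_of_lt _ (by omega : i < m - 1)]
  exact letterClass_comm hij

theorem wordClass_ascendingWord {m r : ℕ} (hr : r ≤ m) :
    wordClass (ascendingWord m r hr) = ascendingProd (genClass m true) (r - 1) := by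
  rw [wordClass, ascendingWord, ascendingProd, List.map_map, ← List.map_coe_finRange_eq_range,
    List.map_map]
  congr 1
  refine List.map_congr_left fun i _ => ?_
  have h : (i : ℕ) < m - 1 := by omega
  simp only [Function.comp_apply]
  rw [genClass_of_lt _ h]
  rfl

theorem letterClass_not_mul {m : ℕ} (l : Fin (m - 1) × Bool) :
    letterClass (l.1, !l.2) * letterClass l = 1 := by
  obtain ⟨i, ε⟩ := l
  cases ε
  · exact letterClass_mul_inverse i
  · exact letterClass_inverse_mul i

theorem wordClass_inverse_mul {m : ℕ} (w : BraidWord m) :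
    wordClass w.inverse * wordClass w = 1 := by
  induction w with
  | nil => exact one_mul _
  | cons l w ih =>
    have e : BraidWord.inverse (l :: w) = BraidWord.inverse w ++ [(l.1, !l.2)] := by
      simp [BraidWord.inverse]
    rw [e, wordClass_append, wordClass_cons, wordClass_cons, wordClass_nil, mul_one, mul_assoc,
      ← mul_assoc (letterClass (l.1, !l.2)), letterClass_not_mul, one_mul, ih]

/-- The word with the letters `c + k - 1, …, c + 1, c`, all of sign `ε`. -/
def descendingWord {m : ℕ} (c : ℕ) (ε : Bool) : (k : ℕ) → c + k ≤ m - 1 → BraidWord m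
  | 0, _ => []
  | k + 1, h => (⟨c + k, by omega⟩, ε) :: descendingWord c ε k (by omega)

theorem wordClass_descendingWord {m c : ℕ} (ε : Bool) {k : ℕ} (h : c + k ≤ m - 1) :
    wordClass (descendingWord c ε k h) = descendingProd (genClass m ε) c k := by
  induction k with
  | zero => rfl
  | succ k ih =>
    rw [descendingWord, wordClass_cons, ih, descendingProd, genClass_of_lt _ (by omega)]

theorem ascendingProd_mul_descendingProd {m k : ℕ} (h : k ≤ m - 1) :
    ascendingProd (genClass m true) k * descendingProd (genClass m false) 0 k = 1 := by
  induction k with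
  | zero => exact one_mul _
  | succ k ih =>
    rw [ascendingProd_succ, descendingProd, zero_add, mul_assoc, ← mul_assoc (genClass m true k),
      genClass_of_lt _ (by omega : k < m - 1), genClass_of_lt _ (by omega : k < m - 1),
      letterClass_mul_inverse, one_mul, ih (by omega)]

/-- Both sides are one-sided inverses of the same ascending product, one on the left and one on the
right, so they agree. -/
theorem wordClass_inverse_ascendingWord {m r : ℕ} (hr : r ≤ m) :
    wordClass (ascendingWord m r hr).inverse = descendingProd (genClass m false) 0 (r - 1) := by
  have h1 := wordClass_inverse_mul (ascendingWord m r hr)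
  rw [wordClass_ascendingWord] at h1
  exact left_inv_eq_right_inv h1 (ascendingProd_mul_descendingProd (by omega))

/-! ### Reduction of the twisted torus word -/

/-- The `2n`-th power of the ascending word on `2n + 1` strands. -/
def twistPrefix (n : ℕ) : BraidWord (2 * n + 2) :=
  (ascendingWord (2 * n + 2) (2 * n + 1) (Nat.le_succ _)).power (2 * n)

/-- The last strand passing below, followed by the inverse of the full twist. -/
def twistSuffix (n : ℕ) : BraidWord (2 * n + 2) :=
  descendingWord 1 true (2 * n) (by omega) ++
    (ascendingWord (2 * n + 2) (2 * n + 1) (Nat.le_succ _)).inverse.power (2 * n + 1)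

/-- One strand passes below and one strand passes above the others. -/
def spiralWord (n : ℕ) : BraidWord (2 * n + 2) :=
  descendingWord 1 true (2 * n) (by omega) ++ descendingWord 0 false (2 * n) (by omega)

theorem wordClass_twistedTorusWord (n : ℕ) :
    wordClass (twistedTorusWord (2 * n + 2) (2 * n) (2 * n + 1) (Nat.le_succ _) (-1)) =
      wordClass (twistPrefix n ++ twistSuffix n) := by
  have h := ascendingProd_pow (S := genClass (2 * n + 2) true) (N := 2 * n + 1) (c := 0)
    (k := 2 * n) (fun i hi => genClass_braid (by omega)) (fun i j hij hj => genClass_comm hij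
      (by omega)) (by omega)
  simp only [zero_add] at h
  have e : fullTwistWord (2 * n + 2) (2 * n + 1) (Nat.le_succ _) (-1) =
      (ascendingWord (2 * n + 2) (2 * n + 1) (Nat.le_succ _)).inverse.power (2 * n + 1) := by
    rw [fullTwistWord, if_neg (by norm_num)]
    congr 1
    simp
  rw [twistedTorusWord, e, twistPrefix, twistSuffix, wordClass_append, wordClass_append,
    wordClass_append, wordClass_power, wordClass_power, wordClass_power, wordClass_ascendingWord,
    wordClass_ascendingWord, wordClass_descendingWord, ← mul_assoc]
  exact congrArg (· * _) h

/-- With the prefix moved to the end, its 2n positive factors cancel all but one of the 2n + 1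
inverse factors of the full twist. -/
theorem wordClass_twistSuffix_append (n : ℕ) :
    wordClass (twistSuffix n ++ twistPrefix n) = wordClass (spiralWord n) := by
  rw [twistPrefix, twistSuffix, spiralWord, wordClass_append, wordClass_append, wordClass_append,
    wordClass_power, wordClass_power, pow_succ', mul_assoc, mul_assoc,
    pow_mul_pow_eq_one _ (wordClass_inverse_mul _), mul_one, wordClass_inverse_ascendingWord,
    wordClass_descendingWord (c := 0) false]
  rfl

/-! ### The permutation and the layers of the reduced word -/

theorem wordPerm_append {m : ℕ} (w w' : BraidWord m) :
    wordPerm (w ++ w') = wordPerm w' * wordPerm w := by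
  induction w with
  | nil => simp [wordPerm]
  | cons l w ih => simp [wordPerm, ih, mul_assoc]

theorem letterSwap_val {m : ℕ} (l : Fin (m - 1) × Bool) (x : Fin m) :
    ((letterSwap l x : Fin m) : ℕ) =
      if (x : ℕ) = l.1 then (l.1 : ℕ) + 1 else if (x : ℕ) = l.1 + 1 then (l.1 : ℕ) else x := by
  simp only [letterSwap, Equiv.swap_apply_def, lowerPos, upperPos, Fin.ext_iff]
  split_ifs <;> rfl

theorem wordPerm_descendingWord_val {m c : ℕ} (ε : Bool) {k : ℕ} (h : c + k ≤ m - 1) (x : Fin m) :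
    ((wordPerm (descendingWord c ε k h) x : Fin m) : ℕ) =
      if (x : ℕ) = c + k then c else if c ≤ (x : ℕ) ∧ (x : ℕ) < c + k then (x : ℕ) + 1 else x := by
  induction k generalizing x with
  | zero =>
    simp only [descendingWord, wordPerm, Equiv.Perm.one_apply]
    split_ifs <;> omega
  | succ k ih =>
    rw [descendingWord, wordPerm, Equiv.Perm.mul_apply, ih, letterSwap_val]
    simp only
    split_ifs <;> omega

/-- A single strand, the one from position c + k, takes part in every crossing, so only its height
against each of the others matters. -/
theorem wordLayered_descendingWord {m c : ℕ} (ε : Bool) {k : ℕ} (h : c + k ≤ m - 1)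
    {f : Fin m → ℝ} (hf : ∀ x y : Fin m, (x : ℕ) = c + k → c ≤ (y : ℕ) → (y : ℕ) < c + k →
      if ε then f x < f y else f y < f x) : WordLayered f (descendingWord c ε k h) := by
  induction k generalizing f with
  | zero => trivial
  | succ k ih =>
    refine ⟨hf _ _ (by simp [upperPos]; omega) (by simp [lowerPos]) (by simp [lowerPos]),
      ih (by omega) fun x y hx hy hy' => hf _ _ ?_ ?_ ?_⟩ <;> rw [letterSwap_val] <;> simp only <;>
      split_ifs <;> omega

theorem WordLayered.append {m : ℕ} {f f' : Fin m → ℝ} {w w' : BraidWord m}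
    (hff' : ∀ k, f' (wordPerm w k) = f k) (hw : WordLayered f w) (hw' : WordLayered f' w') :
    WordLayered f (w ++ w') := by
  induction w generalizing f with
  | nil =>
    have : f' = f := funext hff'
    rwa [this] at hw'
  | cons l w ih =>
    refine ⟨hw.1, ih (fun k => ?_) hw.2⟩
    rw [← hff', wordPerm, Equiv.Perm.mul_apply]
    simp [letterSwap]

/-- The cycles are 0 → 1 → 3 → ⋯ → 2n - 1 → 0 and 2 → 4 → ⋯ → 2n → 2n + 1 → 2, each of length n + 1.
-/
theorem wordPerm_spiralWord_val {n : ℕ} (hn : 1 ≤ n) (x : Fin (2 * n + 2)) :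
    ((wordPerm (spiralWord n) x : Fin (2 * n + 2)) : ℕ) =
      if (x : ℕ) = 0 then 1 else if (x : ℕ) = 2 * n - 1 then 0
      else if (x : ℕ) = 2 * n then 2 * n + 1 else if (x : ℕ) = 2 * n + 1 then 2 else x + 2 := by
  rw [spiralWord, wordPerm_append, Equiv.Perm.mul_apply, wordPerm_descendingWord_val,
    wordPerm_descendingWord_val]
  have := x.2
  split_ifs <;> omega

/-- Heights of the strands of the reduced word: those of one component are positive and those of
the other one are negative. -/
def spiralHeight (n : ℕ) (k : Fin (2 * n + 2)) : ℝ :=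
  if (k : ℕ) = 0 ∨ ((k : ℕ) % 2 = 1 ∧ (k : ℕ) ≠ 2 * n + 1) then (k : ℕ) + 1 else -((k : ℕ) + 1)

theorem spiralHeight_injective (n : ℕ) : Function.Injective (spiralHeight n) := by
  intro k l h
  have hk : (0 : ℝ) ≤ (k : ℕ) := Nat.cast_nonneg _
  have hl : (0 : ℝ) ≤ (l : ℕ) := Nat.cast_nonneg _
  unfold spiralHeight at h
  split_ifs at h
  · exact Fin.ext (by exact_mod_cast (by linarith : ((k : ℕ) : ℝ) = (l : ℕ)))
  · linarith
  · linarith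
  · exact Fin.ext (by exact_mod_cast (by linarith : ((k : ℕ) : ℝ) = (l : ℕ)))

/-- The strand from 2n + 1 has the lowest height and is the one that passes below. The strand from
2n - 1 has the greatest height and is the one that passes above. -/
theorem wordLayered_spiralWord {n : ℕ} (hn : 1 ≤ n) :
    WordLayered (spiralHeight n) (spiralWord n) := by
  have hle : 1 + 2 * n ≤ 2 * n + 2 - 1 := by omega
  refine WordLayered.append (f' := fun k => spiralHeight n
    ((wordPerm (descendingWord 1 true (2 * n) hle))⁻¹ k)) (fun k => by simp)
    (wordLayered_descendingWord _ _ fun x y hx hy hy' => ?_)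
    (wordLayered_descendingWord _ _ fun x y hx hy hy' => ?_)
  · simp only [if_true, spiralHeight]
    rw [if_neg (by omega)]
    have : ((y : ℕ) : ℝ) < (x : ℕ) := by exact_mod_cast (by omega : (y : ℕ) < x)
    have hk : (0 : ℝ) ≤ (y : ℕ) := Nat.cast_nonneg _
    split_ifs <;> linarith
  · obtain ⟨x', rfl⟩ := (wordPerm (descendingWord 1 true (2 * n) hle)).surjective x
    obtain ⟨y', rfl⟩ := (wordPerm (descendingWord 1 true (2 * n) hle)).surjective y
    have hinv : ∀ (τ : Equiv.Perm (Fin (2 * n + 2))) k, τ⁻¹ (τ k) = k := fun τ k => by simp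
    simp only [Bool.false_eq_true, if_false, hinv]
    rw [wordPerm_descendingWord_val] at hx hy'
    have hx' := x'.2
    have hy2 := y'.2
    -- The first half of the word has moved this strand from 2n - 1 to 2n, where the second half
    -- picks it up.
    have ex : (x' : ℕ) = 2 * n - 1 := by
      split_ifs at hx <;> omega
    unfold spiralHeight
    rw [if_pos (by omega : (x' : ℕ) = 0 ∨ ((x' : ℕ) % 2 = 1 ∧ (x' : ℕ) ≠ 2 * n + 1))]
    have hk : (0 : ℝ) ≤ (y' : ℕ) := Nat.cast_nonneg _
    have hk' : (0 : ℝ) ≤ (x' : ℕ) := Nat.cast_nonneg _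
    split_ifs with h
    · have : (y' : ℕ) < x' := by
        split_ifs at hy' <;> omega
      have : ((y' : ℕ) : ℝ) < (x' : ℕ) := by exact_mod_cast this
      linarith
    · linarith

/-! ### The two orbits -/

/-- The successive positions of the two components of the reduced word. -/
def spiralPos (n : ℕ) (a : Fin 2) (i : ℕ) : ℕ :=
  if a = 0 then 2 * i - 1 else if i < n then 2 * i + 2 else 2 * n + 1

/-- Truncated subtraction gives position 0 at index 0, as the cycle 0, 1, 3, …, 2n - 1 requires. -/
theorem spiralPos_zero (n i : ℕ) : spiralPos n 0 i = 2 * i - 1 := rfl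

theorem spiralPos_one (n i : ℕ) : spiralPos n 1 i = if i < n then 2 * i + 2 else 2 * n + 1 := rfl

theorem fin_two_cases (a : Fin 2) : a = 0 ∨ a = 1 := by omega

theorem spiralPos_lt {n : ℕ} (a : Fin 2) {i : ℕ} (hi : i ≤ n) : spiralPos n a i < 2 * n + 2 := by
  unfold spiralPos; split_ifs <;> omega

theorem spiralPos_strictMono {n : ℕ} (a : Fin 2) {i j : ℕ} (hij : i < j) (hj : j ≤ n) :
    spiralPos n a i < spiralPos n a j := by
  unfold spiralPos; split_ifs <;> omega

/-- The starting positions of the two components of the reduced word. -/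
def spiralStart (n : ℕ) (a : Fin 2) : Fin (2 * n + 2) :=
  ⟨spiralPos n a 0, spiralPos_lt a (Nat.zero_le n)⟩

theorem wordPerm_spiralWord_pow_val {n : ℕ} (hn : 1 ≤ n) (a : Fin 2) {i : ℕ} (hi : i ≤ n) :
    (((wordPerm (spiralWord n) ^ i) (spiralStart n a) : Fin (2 * n + 2)) : ℕ) =
      spiralPos n a i := by
  induction i with
  | zero => rfl
  | succ i ih =>
    rw [pow_succ', Equiv.Perm.mul_apply, wordPerm_spiralWord_val hn, ih (by omega)]
    rcases fin_two_cases a with rfl | rfl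
    · rw [spiralPos_zero, spiralPos_zero]
      split_ifs <;> omega
    · rw [spiralPos_one, spiralPos_one, if_pos (by omega : i < n)]
      split_ifs <;> first | contradiction | omega

theorem wordPerm_spiralWord_pow_succ {n : ℕ} (hn : 1 ≤ n) (a : Fin 2) :
    (wordPerm (spiralWord n) ^ (n + 1)) (spiralStart n a) = spiralStart n a := by
  apply Fin.ext
  rw [pow_succ', Equiv.Perm.mul_apply, wordPerm_spiralWord_val hn,
    wordPerm_spiralWord_pow_val hn a le_rfl]
  simp only [spiralStart]
  rcases fin_two_cases a with rfl | rfl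
  · rw [spiralPos_zero, spiralPos_zero]
    split_ifs <;> omega
  · rw [spiralPos_one, spiralPos_one, if_neg (by omega : ¬ n < n)]
    split_ifs <;> first | contradiction | omega

theorem exists_spiralPos {n : ℕ} (k : Fin (2 * n + 2)) :
    ∃ a : Fin 2, ∃ i ≤ n, spiralPos n a i = k := by
  have := k.2
  by_cases h0 : (k : ℕ) = 0
  · exact ⟨0, 0, by omega, by simp [spiralPos, h0]⟩
  by_cases h1 : (k : ℕ) = 2 * n + 1
  · exact ⟨1, n, le_rfl, by simp [spiralPos, h1]⟩
  by_cases h2 : (k : ℕ) % 2 = 1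
  · exact ⟨0, (k + 1) / 2, by omega, by simp [spiralPos]; omega⟩
  · refine ⟨1, (k - 2) / 2, by omega, ?_⟩
    simp only [spiralPos, one_ne_zero, if_false]
    rw [if_pos (by omega)]
    omega

theorem spiralPos_injective {n : ℕ} {a b : Fin 2} {i j : ℕ} (hi : i ≤ n) (hj : j ≤ n)
    (h : spiralPos n a i = spiralPos n b j) : a = b ∧ i = j := by
  rcases fin_two_cases a with rfl | rfl <;> rcases fin_two_cases b with rfl | rfl <;>
    simp only [spiralPos_zero, spiralPos_one, true_and] at h ⊢ <;> (try split_ifs at h) <;> omega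

theorem zpow_apply_eq_pow_emod {m q : ℕ} (hq : 0 < q) {τ : Equiv.Perm (Fin m)} {k : Fin m}
    (hk : (τ ^ q) k = k) (j : ℤ) : (τ ^ j) k = (τ ^ (j % q).toNat) k := by
  have hfix : ∀ i : ℤ, ((τ ^ q) ^ i) k = k := fun i =>
    Function.IsFixedPt.perm_zpow (e := τ ^ q) hk i
  have e : τ ^ j = τ ^ (j % q) * (τ ^ q) ^ (j / q) := by
    rw [← zpow_natCast τ q, ← zpow_mul, ← zpow_add, Int.emod_add_mul_ediv]
  rw [e, Equiv.Perm.mul_apply, hfix, ← zpow_natCast,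
    Int.toNat_of_nonneg (Int.emod_nonneg _ (by omega))]

theorem orbitsOfLength_spiralWord {n : ℕ} (hn : 1 ≤ n) :
    OrbitsOfLength (n + 1) (wordPerm (spiralWord n)) (spiralStart n) := by
  refine ⟨wordPerm_spiralWord_pow_succ hn, fun a b j h => ?_⟩
  rw [zpow_apply_eq_pow_emod (by omega : 0 < n + 1) (wordPerm_spiralWord_pow_succ hn b)] at h
  have h1 := congrArg Fin.val h
  have hlt := Int.emod_lt_of_pos j (by omega : (0 : ℤ) < (n + 1 : ℕ))
  have hnn := Int.emod_nonneg j (by omega : ((n + 1 : ℕ) : ℤ) ≠ 0)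
  rw [wordPerm_spiralWord_pow_val hn b (by omega)] at h1
  obtain ⟨hab, h2⟩ := spiralPos_injective (Nat.zero_le n) (by omega) h1
  exact ⟨hab, Int.dvd_of_emod_eq_zero (by omega)⟩

theorem exists_zpow_spiralStart {n : ℕ} (hn : 1 ≤ n) (k : Fin (2 * n + 2)) :
    ∃ (a : Fin 2) (j : ℤ), (wordPerm (spiralWord n) ^ j) (spiralStart n a) = k := by
  obtain ⟨a, i, hi, h⟩ := exists_spiralPos k
  exact ⟨a, i, Fin.ext (by rw [zpow_natCast, wordPerm_spiralWord_pow_val hn a hi, h])⟩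

/-! ### Spiral braids -/

/-- The path that moves the points along straight lines, spread out to different heights. -/
def linearPath {m : ℕ} (τ : Equiv.Perm (Fin m)) {h : Fin m → ℝ} (hh : Function.Injective h) :
    Path (gridConf 1) (gridConf τ) where
  toFun u := ⟨fun k => ((1 - (u : ℝ)) * (k : ℕ) + u * ((τ k : Fin m) : ℕ),
      h k * (u * (1 - u))), fun k l hkl => by
    obtain ⟨h1, h2⟩ := Prod.mk.inj hkl
    have h3 : (h k - h l) * ((u : ℝ) * (1 - u)) = 0 := by linear_combination h2
    rcases mul_eq_zero.1 h3 with h0 | h0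
    · exact hh (sub_eq_zero.1 h0)
    · rcases mul_eq_zero.1 h0 with h0 | h0
      · rw [h0] at h1
        exact Fin.ext (by exact_mod_cast (by linarith : ((k : ℕ) : ℝ) = (l : ℕ)))
      · have h0 : (u : ℝ) = 1 := by linarith
        rw [h0] at h1
        exact τ.injective (Fin.ext (by
          exact_mod_cast (by linarith : (((τ k : Fin m) : ℕ) : ℝ) = ((τ l : Fin m) : ℕ)))),
    fun k => by
      have h1 : (0 : ℝ) ≤ (1 - (u : ℝ)) * (k : ℕ) :=
        mul_nonneg (by linarith [u.2.2]) (Nat.cast_nonneg _)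
      have h2 : (0 : ℝ) ≤ u * ((τ k : Fin m) : ℕ) := mul_nonneg u.2.1 (Nat.cast_nonneg _)
      simp only
      linarith⟩
  continuous_toFun := Continuous.subtype_mk (continuous_pi fun k => by fun_prop) _
  source' := by
    apply Subtype.ext
    funext k
    simp [gridConf]
  target' := by
    apply Subtype.ext
    funext k
    simp [gridConf]

theorem layeredPath_linearPath {m : ℕ} (τ : Equiv.Perm (Fin m)) {h : Fin m → ℝ}
    (hh : Function.Injective h) : LayeredPath h (linearPath τ hh) := by
  intro u k l hkl hx
  have hne : h k - h l ≠ 0 := sub_ne_zero.2 fun e => hkl (hh e)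
  have hsq : 0 < (h k - h l) ^ 2 := by positivity
  have hb0 : (0 : ℝ) ≤ u * (1 - u) := mul_nonneg u.2.1 (by linarith [u.2.2])
  have e : (((linearPath τ hh u).1 k).2 - ((linearPath τ hh u).1 l).2) * (h k - h l) =
      (h k - h l) ^ 2 * (u * (1 - u)) := by
    simp only [linearPath, Path.coe_mk_mk]; ring
  rw [e]
  refine mul_pos hsq (lt_of_le_of_ne hb0 fun h0 => hkl ((linearPath τ hh u).2.1 (Prod.ext hx ?_)))
  simp only [linearPath, Path.coe_mk_mk, ← h0, mul_zero]

/-- By periodicity every time reduces to i + u with 0 ≤ i ≤ n, and times that differ by an integer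
share the same u. It is enough to compare finitely many strands over each u. -/
theorem closedBraid_of_index {n : ℕ} {Z : Fin 2 → ℝ → ℝ × ℝ}
    (hp : ∀ a x, Z a (x + (n + 1 : ℕ)) = Z a x) (hax : ∀ a x, -1 < (Z a x).1)
    (h01 : ∀ i ≤ n, ∀ i' ≤ n, ∀ u ∈ Set.Ico (0 : ℝ) 1, Z 0 ((i : ℕ) + u) ≠ Z 1 ((i' : ℕ) + u))
    (haa : ∀ a, ∀ i i' : ℕ, i < i' → i' ≤ n → ∀ u ∈ Set.Ico (0 : ℝ) 1,
      Z a (i + u) ≠ Z a (i' + u)) : ClosedBraid (n + 1) Z := by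
  have hpos : (0 : ℤ) < (n + 1 : ℕ) := by omega
  have hper : ∀ a x, ∃ i : ℕ, i ≤ n ∧ (i : ℤ) = ⌊x⌋ % (n + 1 : ℕ) ∧
      Z a x = Z a (i + Int.fract x) := by
    intro a x
    have h1 := Int.emod_nonneg ⌊x⌋ hpos.ne'
    have h2 := Int.emod_lt_of_pos ⌊x⌋ hpos
    refine ⟨(⌊x⌋ % (n + 1 : ℕ)).toNat, by omega, by omega, ?_⟩
    have hq : Function.Periodic (Z a) ((n + 1 : ℕ) : ℝ) := hp a
    rw [← hq.int_mul (⌊x⌋ / (n + 1 : ℕ)) ((⌊x⌋ % (n + 1 : ℕ)).toNat + Int.fract x)]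
    congr 1
    have h3 : (((⌊x⌋ % (n + 1 : ℕ)).toNat : ℤ) : ℝ) = ((⌊x⌋ % (n + 1 : ℕ) : ℤ) : ℝ) := by
      rw [Int.toNat_of_nonneg h1]
    have h4 : ((⌊x⌋ % (n + 1 : ℕ) : ℤ) : ℝ) + ((⌊x⌋ / (n + 1 : ℕ) : ℤ) : ℝ) * ((n + 1 : ℕ) : ℝ) =
        ⌊x⌋ := by
      have := Int.emod_add_mul_ediv ⌊x⌋ (n + 1 : ℕ)
      rw [mul_comm] at this
      exact_mod_cast this
    rw [Int.cast_natCast] at h3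
    linarith [Int.floor_add_fract x]
  refine ⟨hp, fun a b x j h => ?_, hax⟩
  obtain ⟨i, hi, hi1, hi2⟩ := hper a x
  obtain ⟨i', hi', hi1', hi2'⟩ := hper b (x + j)
  rw [hi2, hi2', Int.fract_add_intCast] at h
  have hu : Int.fract x ∈ Set.Ico (0 : ℝ) 1 := ⟨Int.fract_nonneg x, Int.fract_lt_one x⟩
  have hab : a = b := by
    rcases fin_two_cases a with rfl | rfl <;> rcases fin_two_cases b with rfl | rfl
    · rfl
    · exact absurd h (h01 i hi i' hi' _ hu)
    · exact absurd h.symm (h01 i' hi' i hi _ hu)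
    · rfl
  subst hab
  refine ⟨rfl, ?_⟩
  rcases lt_trichotomy i i' with hlt | heq | hlt
  · exact absurd h (haa a i i' hlt hi' _ hu)
  · rw [Int.floor_add_intCast] at hi1'
    have h2 : ⌊x⌋ % (n + 1 : ℕ) = (⌊x⌋ + j) % (n + 1 : ℕ) := by rw [← hi1, ← hi1', heq]
    have h3 := Int.emod_eq_emod_iff_emod_sub_eq_zero.1 h2.symm
    rw [add_sub_cancel_left] at h3
    exact Int.dvd_of_emod_eq_zero h3
  · exact absurd h.symm (haa a i' i hlt hi _ hu)

/-! ### Order of strands along the torus braid -/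

theorem cos_lt_cos_of_closer {q A B : ℝ} (hq : 0 < q) (hA : 0 ≤ A) (hAB : A < B)
    (hB : A < q - B) : Real.cos (2 * Real.pi * B / q) < Real.cos (2 * Real.pi * A / q) := by
  have hpi := Real.pi_pos
  have mono : ∀ C, A < C → C ≤ q / 2 →
      Real.cos (2 * Real.pi * C / q) < Real.cos (2 * Real.pi * A / q) := by
    intro C hC hCq
    apply Real.cos_lt_cos_of_nonneg_of_le_pi (by positivity)
    · rw [div_le_iff₀ hq]; nlinarith
    · gcongr
  rcases le_total B (q / 2) with h | h
  · exact mono B hAB h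
  · have e : Real.cos (2 * Real.pi * B / q) = Real.cos (2 * Real.pi * (q - B) / q) := by
      have : 2 * Real.pi * (q - B) / q = 2 * Real.pi - 2 * Real.pi * B / q := by
        field_simp
      rw [this, Real.cos_two_pi_sub]
    rw [e]
    exact mono _ hB (by linarith)

/-- Equal cosines force x and y to opposite sides of π, where the sines have opposite signs. -/
theorem sin_lt_sin_of_cos_eq {x y : ℝ} (hx : 0 < x) (hxy : x < y) (hy : y < 2 * Real.pi)
    (h : Real.cos x = Real.cos y) : Real.sin y < Real.sin x := by
  have h1 : x < Real.pi := by
    by_contra hc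
    have := Real.cos_lt_cos_of_nonneg_of_le_pi (x := 2 * Real.pi - y) (y := 2 * Real.pi - x)
      (by linarith) (by linarith) (by linarith)
    rw [Real.cos_two_pi_sub, Real.cos_two_pi_sub] at this
    linarith
  have h2 : Real.pi < y := by
    by_contra hc
    have := Real.cos_lt_cos_of_nonneg_of_le_pi hx.le (by linarith : y ≤ Real.pi) hxy
    linarith
  have h3 := Real.sin_pos_of_pos_of_lt_pi hx h1
  have h4 := Real.sin_pos_of_pos_of_lt_pi (by linarith : 0 < 2 * Real.pi - y) (by linarith)
  rw [Real.sin_two_pi_sub] at h4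
  linarith

/-- The angle of the torus braid with respect to its highest point, at time `x`. -/
def torusAngle (n : ℕ) (x : ℝ) : ℝ := 2 * Real.pi * (x + 1 / 2) / (n + 1 : ℕ)

theorem torusAngle_last {n : ℕ} (u : ℝ) :
    torusAngle n (n + u) = 2 * Real.pi * (u - 1 / 2) / (n + 1 : ℕ) + 2 * Real.pi := by
  have : ((n + 1 : ℕ) : ℝ) ≠ 0 := by positivity
  unfold torusAngle
  field_simp
  push_cast
  ring

/-- The shift by 1/2 in the angle centres the last strand at the peak, so it is within half a turn
about the axis of the peak and the other strands are farther away. At u = 0 and i = 0 there is a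
tie, hence the exclusion. -/
theorem cos_torusAngle_lt_last {n i : ℕ} (hi : i < n) {u : ℝ} (hu : u ∈ Set.Ico (0 : ℝ) 1)
    (h0 : 0 < u ∨ 0 < i) : Real.cos (torusAngle n (i + u)) < Real.cos (torusAngle n (n + u)) := by
  have hq : (0 : ℝ) < (n + 1 : ℕ) := by positivity
  have hin : (i : ℝ) + 1 ≤ n := by exact_mod_cast hi
  have hi0 : (0 : ℝ) ≤ i := Nat.cast_nonneg i
  have e : Real.cos (torusAngle n (n + u)) =
      Real.cos (2 * Real.pi * |u - 1 / 2| / (n + 1 : ℕ)) := by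
    rw [torusAngle_last, Real.cos_add_two_pi]
    rcases abs_cases (u - 1 / 2) with ⟨h, -⟩ | ⟨h, -⟩
    · rw [h]
    · rw [h, ← Real.cos_neg]; congr 1; ring
  rw [e, torusAngle]
  have hu0 := hu.1
  have hu1 := hu.2
  have h0' : 0 < u ∨ (1 : ℝ) ≤ i := h0.imp id fun h => by exact_mod_cast h
  apply cos_lt_cos_of_closer hq (abs_nonneg _)
  · rw [abs_lt]
    constructor
    · rcases h0' with h | h <;> linarith
    · linarith
  · push_cast
    rw [abs_lt]
    constructor <;> linarith

theorem sin_torusAngle_last_lt {n : ℕ} (hn : 1 ≤ n) :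
    Real.sin (torusAngle n ((n : ℕ) + 0)) < Real.sin (torusAngle n ((0 : ℕ) + 0)) ∧
      Real.cos (torusAngle n ((n : ℕ) + 0)) = Real.cos (torusAngle n ((0 : ℕ) + 0)) := by
  have e1 : torusAngle n ((n : ℕ) + 0) = -(Real.pi / (n + 1 : ℕ)) + 2 * Real.pi := by
    rw [torusAngle_last]; ring
  have e2 : torusAngle n ((0 : ℕ) + 0) = Real.pi / (n + 1 : ℕ) := by
    rw [torusAngle]; push_cast; ring
  have hq : (2 : ℝ) ≤ (n + 1 : ℕ) := by exact_mod_cast (by omega : 2 ≤ n + 1)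
  have hpi := Real.pi_pos
  have hlt : Real.pi / (n + 1 : ℕ) < Real.pi := by
    rw [div_lt_iff₀ (by linarith)]; nlinarith
  have hs := Real.sin_pos_of_pos_of_lt_pi (x := Real.pi / (n + 1 : ℕ)) (by positivity) hlt
  rw [e1, e2, Real.sin_add_two_pi, Real.cos_add_two_pi, Real.sin_neg, Real.cos_neg]
  exact ⟨by linarith, rfl⟩

theorem sin_torusAngle_lt {n i i' : ℕ} (hii' : i < i') (hi' : i' < n) {u : ℝ}
    (hu : u ∈ Set.Ico (0 : ℝ) 1)
    (h : Real.cos (torusAngle n (i + u)) = Real.cos (torusAngle n (i' + u))) :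
    Real.sin (torusAngle n (i' + u)) < Real.sin (torusAngle n (i + u)) := by
  have hq : (0 : ℝ) < (n + 1 : ℕ) := by positivity
  have h1 : (i : ℝ) < i' := by exact_mod_cast hii'
  have h2 : (i' : ℝ) + 1 ≤ n := by exact_mod_cast hi'
  have h0 : (0 : ℝ) ≤ i := Nat.cast_nonneg i
  have hpi := Real.pi_pos
  have hu0 := hu.1
  have hu1 := hu.2
  refine sin_lt_sin_of_cos_eq ?_ ?_ ?_ h
  · unfold torusAngle; positivity
  · unfold torusAngle; gcongr
  · unfold torusAngle
    rw [div_lt_iff₀ hq]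
    push_cast
    nlinarith

/-- The closed braid of the reduced word, with strands moving along straight lines. -/
def spiralBraid (n : ℕ) : Fin 2 → ℝ → ℝ × ℝ :=
  braidLoop (wordPerm (spiralWord n)) (spiralStart n)
    (pathMotion (linearPath (wordPerm (spiralWord n)) (spiralHeight_injective n)))

theorem closedBraid_spiralBraid {n : ℕ} (hn : 1 ≤ n) : ClosedBraid (n + 1) (spiralBraid n) :=
  (strandMotion_pathMotion _).closedBraid (orbitsOfLength_spiralWord hn)

theorem continuous_spiralBraid (n : ℕ) (a : Fin 2) : Continuous (spiralBraid n a) :=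
  continuous_braidLoop (strandMotion_pathMotion _) (continuous_pathMotion _) _ a

theorem spiralHeight_of_val {n : ℕ} (a : Fin 2) {i : ℕ} (hi : i ≤ n) {k : Fin (2 * n + 2)}
    (hk : (k : ℕ) = spiralPos n a i) : spiralHeight n k = sheetSign a * (spiralPos n a i + 1) := by
  unfold spiralHeight
  rw [hk]
  rcases fin_two_cases a with rfl | rfl
  · rw [spiralPos_zero, if_pos (by omega), sheetSign_zero, one_mul]
  · have hneg : ¬ (spiralPos n 1 i = 0 ∨ (spiralPos n 1 i % 2 = 1 ∧
        spiralPos n 1 i ≠ 2 * n + 1)) := by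
      rcases hi.lt_or_eq with h | rfl
      · rw [spiralPos_one, if_pos h]; omega
      · rw [spiralPos_one, if_neg (lt_irrefl _)]; omega
    rw [if_neg hneg, sheetSign_one]
    ring

/-- The position of a strand after one more turn. -/
def spiralNext (n : ℕ) (a : Fin 2) (i : ℕ) : ℕ :=
  if i < n then spiralPos n a (i + 1) else spiralPos n a 0

theorem spiralBraid_index {n : ℕ} (hn : 1 ≤ n) (a : Fin 2) {i : ℕ} (hi : i ≤ n) {u : ℝ}
    (hu : u ∈ Set.Ico (0 : ℝ) 1) : spiralBraid n a (i + u) =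
      ((1 - u) * spiralPos n a i + u * spiralNext n a i,
        sheetSign a * (spiralPos n a i + 1) * (u * (1 - u))) := by
  have hfl : ⌊(i : ℝ) + u⌋ = i := by
    rw [Int.floor_eq_iff]; push_cast; exact ⟨by linarith [hu.1], by linarith [hu.2]⟩
  have hfr : Int.fract ((i : ℝ) + u) = u := by
    rw [Int.fract, hfl]; push_cast; ring
  have hv := wordPerm_spiralWord_pow_val hn a hi
  have hnext : ((wordPerm (spiralWord n) ((wordPerm (spiralWord n) ^ i) (spiralStart n a)) :
      Fin (2 * n + 2)) : ℕ) = spiralNext n a i := by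
    rw [← Equiv.Perm.mul_apply, ← pow_succ', spiralNext]
    split_ifs with h
    · exact wordPerm_spiralWord_pow_val hn a h
    · obtain rfl : i = n := by omega
      rw [wordPerm_spiralWord_pow_succ hn]
      rfl
  simp only [spiralBraid, braidLoop, hfl, hfr, zpow_natCast, pathMotion]
  rw [Set.projIcc_of_mem _ ⟨hu.1, hu.2.le⟩]
  simp only [linearPath, Path.coe_mk_mk]
  rw [hnext, spiralHeight_of_val a hi hv, hv]

/-- Two strands of one component: either the first coordinates are in order, or the second one
is the last strand, and lies above the other one. -/
theorem spiralBraid_compare {n : ℕ} (hn : 1 ≤ n) (a : Fin 2) {i i' : ℕ} (h : i < i') (hi' : i' ≤ n)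
    {u : ℝ} (hu : u ∈ Set.Ico (0 : ℝ) 1) :
    (spiralBraid n a (i + u)).1 < (spiralBraid n a (i' + u)).1 ∨
      (i' = n ∧ 0 < u ∧ 0 < sheetSign a *
        ((spiralBraid n a (i' + u)).2 - (spiralBraid n a (i + u)).2)) := by
  rw [spiralBraid_index hn a hi' hu, spiralBraid_index hn a (by omega) hu]
  simp only
  have h1 : (spiralPos n a i : ℝ) < spiralPos n a i' := by
    exact_mod_cast spiralPos_strictMono a h hi'
  rcases eq_or_lt_of_le hu.1 with h0 | h0
  · left
    rw [← h0]; linarith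
  rcases lt_or_eq_of_le hi' with hlt | rfl
  · left
    rw [spiralNext, spiralNext, if_pos hlt, if_pos (by omega)]
    have h2 : (spiralPos n a (i + 1) : ℝ) < spiralPos n a (i' + 1) := by
      exact_mod_cast spiralPos_strictMono a (by omega) (by omega)
    nlinarith [hu.2]
  · right
    refine ⟨rfl, h0, ?_⟩
    have hs : sheetSign a * sheetSign a = 1 := by
      rcases fin_two_cases a with rfl | rfl <;> norm_num [sheetSign_zero, sheetSign_one]
    have e : sheetSign a * (sheetSign a * ((spiralPos i' a i' : ℝ) + 1) * (u * (1 - u)) -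
        sheetSign a * ((spiralPos i' a i : ℝ) + 1) * (u * (1 - u))) =
        (sheetSign a * sheetSign a) * ((spiralPos i' a i' - spiralPos i' a i) * (u * (1 - u))) := by
      ring
    rw [e, hs, one_mul]
    exact mul_pos (by linarith) (mul_pos h0 (by linarith [hu.2]))

theorem spiralBraid_snd_sign {n : ℕ} (hn : 1 ≤ n) (a : Fin 2) {i : ℕ} (hi : i ≤ n) {u : ℝ}
    (hu : u ∈ Set.Ico (0 : ℝ) 1) : 0 ≤ sheetSign a * (spiralBraid n a (i + u)).2 := by
  rw [spiralBraid_index hn a hi hu]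
  have e : sheetSign a * (sheetSign a * ((spiralPos n a i : ℝ) + 1) * (u * (1 - u))) =
      sheetSign a ^ 2 * ((spiralPos n a i : ℝ) + 1) * (u * (1 - u)) := by ring
  rw [e]
  exact mul_nonneg (by positivity) (mul_nonneg hu.1 (by linarith [hu.2]))

theorem torusBraid_half {n : ℕ} (a : Fin 2) (x : ℝ) : torusBraid (n + 1) a (x + 1 / 2) =
    (1 - Real.sin (torusAngle n x), sheetSign a * (5 + Real.cos (torusAngle n x))) := rfl

/-! ### From the spiral braid to the torus braid -/

/-- The first coordinate of the spiral braid, with the heights of the torus braid. -/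
def mixedBraid (n : ℕ) (a : Fin 2) (x : ℝ) : ℝ × ℝ :=
  ((spiralBraid n a x).1, sheetSign a * (5 + Real.cos (torusAngle n x)))

theorem torusAngle_add (n : ℕ) (x : ℝ) :
    torusAngle n (x + (n + 1 : ℕ)) = torusAngle n x + 2 * Real.pi := by
  have : ((n + 1 : ℕ) : ℝ) ≠ 0 := by positivity
  unfold torusAngle
  field_simp
  ring

theorem continuous_torusAngle (n : ℕ) : Continuous (torusAngle n) := by
  unfold torusAngle; fun_prop

theorem continuous_mixedBraid (n : ℕ) (a : Fin 2) : Continuous (mixedBraid n a) :=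
  (continuous_spiralBraid n a).fst.prodMk (continuous_const.mul (continuous_const.add
    (Real.continuous_cos.comp (continuous_torusAngle n))))

theorem ne_of_sheets {y y' : ℝ} (h : 0 < sheetSign 0 * y) (h' : 0 < sheetSign 1 * y') : y ≠ y' := by
  rw [sheetSign_zero] at h
  rw [sheetSign_one] at h'
  intro e
  linarith

theorem five_add_cos_pos (x : ℝ) : 0 < 5 + Real.cos x := by linarith [Real.neg_one_le_cos x]

theorem sheetSign_mul_self_mul (a : Fin 2) (y : ℝ) : sheetSign a * (sheetSign a * y) = y := by
  rcases fin_two_cases a with rfl | rfl <;> simp [sheetSign_zero, sheetSign_one]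

/-- The first coordinates are kept. Within a component they agree only if one of the strands is the
last, and that strand is farther from z = 0 in both braids, hence in every convex combination. The
sign of the height separates the components. -/
theorem spiralBraid_homotopic_mixedBraid {n : ℕ} (hn : 1 ≤ n) :
    BraidHomotopic (n + 1) (spiralBraid n) (mixedBraid n) := by
  have hc := closedBraid_spiralBraid hn
  refine BraidHomotopic.of_segment (continuous_spiralBraid n) (continuous_mixedBraid n)
    fun t ht => ?_
  -- The start is treated apart: the spiral braid has height 0 at integer times, so only for t > 0
  -- are the sheets strictly separated.
  rcases eq_or_lt_of_le ht.1 with rfl | h0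
  · simpa using hc
  have e1 : ∀ a x, ((1 - t) • spiralBraid n a x + t • mixedBraid n a x).1 =
      (spiralBraid n a x).1 := fun a x => by
    simp only [mixedBraid, Prod.fst_add, Prod.smul_fst, smul_eq_mul]; ring
  have e2 : ∀ a x, sheetSign a * ((1 - t) • spiralBraid n a x + t • mixedBraid n a x).2 =
      (1 - t) * (sheetSign a * (spiralBraid n a x).2) + t * (5 + Real.cos (torusAngle n x)) :=
    fun a x => by
      simp only [mixedBraid, Prod.snd_add, Prod.smul_snd, smul_eq_mul]
      rw [mul_add, mul_left_comm (sheetSign a) t, sheetSign_mul_self_mul]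
      ring
  refine closedBraid_of_index (fun a x => ?_) (fun a x => ?_) (fun i hi i' hi' u hu h => ?_)
    (fun a i i' hii' hi' u hu h => ?_)
  · simp only [mixedBraid, hc.periodic, torusAngle_add, Real.cos_add_two_pi]
  · rw [e1]; exact hc.off_axis a x
  · refine ne_of_sheets ?_ ?_ (congrArg Prod.snd h)
    · rw [e2]
      exact add_pos_of_nonneg_of_pos (mul_nonneg (by linarith [ht.2])
        (spiralBraid_snd_sign hn 0 hi hu)) (mul_pos h0 (five_add_cos_pos _))
    · rw [e2]
      exact add_pos_of_nonneg_of_pos (mul_nonneg (by linarith [ht.2])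
        (spiralBraid_snd_sign hn 1 hi' hu)) (mul_pos h0 (five_add_cos_pos _))
  · have h1 := congrArg Prod.fst h
    rw [e1, e1] at h1
    rcases spiralBraid_compare hn a hii' hi' hu with hlt | ⟨rfl, hu0, hy⟩
    · linarith
    · have h2 := congrArg (fun z => sheetSign a * z.2) h
      rw [e2, e2] at h2
      have hcos := cos_torusAngle_lt_last hii' hu (Or.inl hu0)
      have h3 : 0 ≤ (1 - t) * (sheetSign a * ((spiralBraid i' a (i' + u)).2 -
        (spiralBraid i' a (i + u)).2)) := mul_nonneg (by linarith [ht.2]) hy.le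
      have h4 := mul_pos h0 (sub_pos.2 hcos)
      nlinarith

/-- The heights are kept. Two strands of one component at equal height are ordered alike by the
first coordinates of both braids, so interpolation cannot merge them. The last strand is strictly
farther from z = 0 than the others, except in the tie at u = 0, i = 0, where the orders agree too.
-/
theorem mixedBraid_segment_closedBraid {n : ℕ} (hn : 1 ≤ n) {t : ℝ}
    (ht : t ∈ Set.Icc (0 : ℝ) 1) : ClosedBraid (n + 1)
      (fun a x => (1 - t) • mixedBraid n a x + t • torusBraid (n + 1) a (x + 1 / 2)) := by
  have hc := closedBraid_spiralBraid hn
  have e1 : ∀ a x, ((1 - t) • mixedBraid n a x + t • torusBraid (n + 1) a (x + 1 / 2)).1 =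
      (1 - t) * (spiralBraid n a x).1 + t * (1 - Real.sin (torusAngle n x)) := fun a x => by
    simp only [mixedBraid, torusBraid_half, Prod.fst_add, Prod.smul_fst, smul_eq_mul]
  have e2 : ∀ a x, sheetSign a * ((1 - t) • mixedBraid n a x +
      t • torusBraid (n + 1) a (x + 1 / 2)).2 = 5 + Real.cos (torusAngle n x) := fun a x => by
    simp only [mixedBraid, torusBraid_half, Prod.snd_add, Prod.smul_snd, smul_eq_mul]
    rw [← add_mul, sub_add_cancel, one_mul, sheetSign_mul_self_mul]
  refine closedBraid_of_index (fun a x => ?_) (fun a x => ?_) (fun i hi i' hi' u hu h => ?_)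
    (fun a i i' hii' hi' u hu h => ?_)
  · simp only [mixedBraid, torusBraid_half, hc.periodic, torusAngle_add, Real.cos_add_two_pi,
      Real.sin_add_two_pi]
  · rw [e1]
    have h1 := hc.off_axis a x
    have h2 := Real.sin_le_one (torusAngle n x)
    rcases eq_or_lt_of_le ht.2 with rfl | hlt
    · linarith
    · nlinarith [ht.1]
  · refine ne_of_sheets ?_ ?_ (congrArg Prod.snd h) <;> rw [e2] <;> exact five_add_cos_pos _
  · have h1 := congrArg Prod.fst h
    have h2 := congrArg (fun z => sheetSign a * z.2) h
    rw [e1, e1] at h1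
    rw [e2, e2] at h2
    have hlt : Real.sin (torusAngle n (i' + u)) < Real.sin (torusAngle n (i + u)) →
        ¬ (spiralBraid n a (i + u)).1 < (spiralBraid n a (i' + u)).1 := by
      intro hs hX
      rcases eq_or_lt_of_le ht.1 with rfl | h0
      · linarith
      · nlinarith [mul_pos h0 (sub_pos.2 hs), mul_nonneg (sub_nonneg.2 ht.2) (sub_pos.2 hX).le]
    rcases lt_or_eq_of_le hi' with hi'n | rfl
    · refine hlt (sin_torusAngle_lt hii' hi'n hu (by linarith)) ?_
      rcases spiralBraid_compare hn a hii' hi' hu with h | ⟨h, -⟩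
      · exact h
      · omega
    · by_cases hz : 0 < u ∨ 0 < i
      · linarith [cos_torusAngle_lt_last hii' hu hz]
      · push Not at hz
        obtain rfl : u = 0 := le_antisymm hz.1 hu.1
        obtain rfl : i = 0 := by omega
        refine hlt (sin_torusAngle_last_lt hn).1 ?_
        rcases spiralBraid_compare hn a hii' hi' hu with h | ⟨-, h, -⟩
        · exact h
        · exact absurd h (lt_irrefl _)

theorem spiralBraid_homotopic_torusBraid {n : ℕ} (hn : 1 ≤ n) :
    BraidHomotopic (n + 1) (spiralBraid n) (torusBraid (n + 1)) := by
  have hct : ∀ a, Continuous fun x => torusBraid (n + 1) a (x + 1 / 2) := fun a =>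
    (contDiff_torusBraid (n + 1) a).continuous.comp (by fun_prop)
  have h2 : BraidHomotopic (n + 1) (mixedBraid n) (fun a x => torusBraid (n + 1) a (x + 1 / 2)) :=
    BraidHomotopic.of_segment (continuous_mixedBraid n) hct fun t ht =>
      mixedBraid_segment_closedBraid hn ht
  have hcl : ClosedBraid (n + 1) (fun a x => torusBraid (n + 1) a (x + 1 / 2)) := by
    simpa using mixedBraid_segment_closedBraid hn (t := 1) (by simp)
  -- This undoes the shift that put the peak of the torus braid in the middle of the last strand.
  have h3 := BraidHomotopic.shift hcl hct (-(1 / 2))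
  simp only [neg_add_cancel_right] at h3
  exact ((spiralBraid_homotopic_mixedBraid hn).trans h2).trans h3

/-! ### Closures of braid words as closed braids -/

theorem OrbitsOfLength.of_semiconjBy {m q : ℕ} {ρ τ τ' : Equiv.Perm (Fin m)}
    (hρ : SemiconjBy ρ τ τ') {s : Fin 2 → Fin m}
    (h : OrbitsOfLength q τ' fun a => ρ (s a)) : OrbitsOfLength q τ s := by
  refine ⟨fun a => ρ.injective ?_, fun a b j hj => h.free a b j ?_⟩
  · rw [← Equiv.Perm.mul_apply, (hρ.pow_right q).eq, Equiv.Perm.mul_apply, h.closed]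
  · rw [← Equiv.Perm.mul_apply, ← (hρ.zpow_right j).eq, Equiv.Perm.mul_apply, ← hj]

theorem braidHomotopic_of_pathClass_eq {m q : ℕ} {τ τ' : Equiv.Perm (Fin m)}
    {s : Fin 2 → Fin m} (hs : OrbitsOfLength q τ s) {γ : Path (gridConf 1) (gridConf τ)}
    {γ' : Path (gridConf 1) (gridConf τ')}
    (h : (⟨τ, Path.Homotopic.Quotient.mk γ⟩ :
      Σ τ : Equiv.Perm (Fin m), Path.Homotopic.Quotient (gridConf 1) (gridConf τ)) =
      ⟨τ', Path.Homotopic.Quotient.mk γ'⟩) :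
    BraidHomotopic q (braidLoop τ s (pathMotion γ)) (braidLoop τ' s (pathMotion γ')) := by
  obtain rfl : τ = τ' := congrArg Sigma.fst h
  exact braidHomotopic_of_homotopic hs ((pathClass_eq_iff rfl _ _).1 h)

/-- The path of configurations of a braid word, starting at the standard labelling. -/
def wordLoopPath {m : ℕ} (w : BraidWord m) : Path (gridConf 1) (gridConf (wordPerm w)) :=
  (wordPath w 1).cast rfl (by rw [mul_one])

theorem wordClass_one {m : ℕ} (w : BraidWord m) :
    wordClass w 1 = ⟨wordPerm w, Path.Homotopic.Quotient.mk (wordLoopPath w)⟩ := by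
  rw [wordClass_apply, pathClass_eq_iff (mul_one _)]
  exact Path.Homotopic.refl _

theorem wordClass_append_one {m : ℕ} (w w' : BraidWord m) :
    wordClass (w ++ w') 1 = ⟨wordPerm w' * wordPerm w,
      Path.Homotopic.Quotient.mk ((wordLoopPath w).trans (wordPath w' (wordPerm w)))⟩ := by
  rw [wordClass_append, MotionMonoid.mul_apply, wordClass_one, wordClass_apply]
  rfl

theorem pathMotion_wordPath {m : ℕ} (w : BraidWord m) (σ : Equiv.Perm (Fin m)) (k : Fin m)
    (x : ℝ) : pathMotion (wordPath w σ) k x = wordMotion w (σ k) ((w.length + 1) * x) := by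
  have hN : (0 : ℝ) ≤ w.length := Nat.cast_nonneg _
  show wordMotion w (σ k) ((w.length + 1) * (Set.projIcc (0 : ℝ) 1 zero_le_one x : ℝ)) = _
  rcases le_total x 0 with h0 | h0
  · rw [Set.projIcc_of_le_left _ h0, wordMotion_start _ _ (by simp),
      wordMotion_start _ _ (mul_nonpos_of_nonneg_of_nonpos (by linarith) h0)]
  rcases le_total x 1 with h1 | h1
  · rw [Set.projIcc_of_mem _ ⟨h0, h1⟩]
  · rw [Set.projIcc_of_right_le _ h1, wordMotion_finish _ _ (by simp),
      wordMotion_finish _ _ (by nlinarith)]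

theorem pathMotion_wordLoopPath {m : ℕ} (w : BraidWord m) (k : Fin m) (x : ℝ) :
    pathMotion (wordLoopPath w) k x = wordMotion w k ((w.length + 1) * x) :=
  pathMotion_wordPath w 1 k x

/-- The closed braid of a word, followed from the starting positions `s`. -/
def wordLoop {m : ℕ} (w : BraidWord m) (s : Fin 2 → Fin m) : Fin 2 → ℝ → ℝ × ℝ :=
  braidLoop (wordPerm w) s (pathMotion (wordLoopPath w))

theorem contDiff_wordLoop {m : ℕ} (w : BraidWord m) (s : Fin 2 → Fin m) (a : Fin 2) :
    ContDiff ℝ ∞ (wordLoop w s a) := by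
  refine contDiff_braidLoop (strandMotion_pathMotion _) (fun k => ?_) s a
  rw [funext (pathMotion_wordLoopPath w k)]
  exact (contDiff_wordMotion w k).comp (contDiff_const.mul contDiff_id)

theorem wordMotion_letter {m : ℕ} (w : BraidWord m) (k : Fin m) {j : ℕ} (hj : j ≤ w.length)
    {u : ℝ} (hu : u ∈ Set.Icc (0 : ℝ) 1) :
    wordMotion w k (j + u) = strandPosition w[j]? (wordPerm (w.take j) k) u := by
  induction w generalizing j k with
  | nil =>
    obtain rfl : j = 0 := by simpa using hj
    rfl
  | cons l w ih =>
    rcases j with _ | j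
    · rw [Nat.cast_zero, zero_add, wordMotion_cons_of_le _ _ _ hu.2]
      rfl
    · have hj0 : (0 : ℝ) ≤ j := Nat.cast_nonneg _
      have e : ((j + 1 : ℕ) : ℝ) + u - 1 = j + u := by push_cast; ring
      rw [wordMotion_cons_of_ge _ _ _ (by push_cast; linarith [hu.1]), e,
        ih _ (by simpa using hj)]
      rfl

theorem wordLoop_add {m : ℕ} (w : BraidWord m) (s : Fin 2 → Fin m) (a : Fin 2) (i : ℤ) {f : ℝ}
    (hf : f ∈ Set.Icc (0 : ℝ) 1) :
    wordLoop w s a (i + f) = wordMotion w ((wordPerm w ^ i) (s a)) ((w.length + 1) * f) := by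
  rw [wordLoop, braidLoop, Int.floor_intCast_add, Int.fract_intCast_add, pathMotion_wordLoopPath]
  rcases hf.2.lt_or_eq with h | rfl
  · rw [Int.floor_eq_zero_iff.2 ⟨hf.1, h⟩, Int.fract_eq_self.2 ⟨hf.1, h⟩, add_zero]
  · rw [Int.floor_one, Int.fract_one, wordMotion_start _ _ (by simp),
      wordMotion_finish _ _ (by simp), add_comm, zpow_one_add, Equiv.Perm.mul_apply]

theorem bookPoint_add_int (x : ℝ) (i : ℤ) (z : ℝ × ℝ) :
    bookPoint (2 * Real.pi * (i + x)) z = bookPoint (2 * Real.pi * x) z := by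
  have e : 2 * Real.pi * (i + x) = 2 * Real.pi * x + i * (2 * Real.pi) := by ring
  rw [bookPoint, e, Real.cos_add_int_mul_two_pi, Real.sin_add_int_mul_two_pi, bookPoint]

/-- The two loops cover the closure because the orbits of the starting positions exhaust all
strands. The path of a word runs at speed length + 1, so one unit of loop time matches the sectors,
including the final one where nothing moves. -/
theorem braidClosure_eq_linkImage {m q : ℕ} (hq : 0 < q) {w : BraidWord m} {s : Fin 2 → Fin m}
    (hs : ∀ k, ∃ (a : Fin 2) (j : ℤ), (wordPerm w ^ j) (s a) = k) :
    braidClosure w = linkImage (closedBraidCurve q (wordLoop w s)) := by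
  have hq' : (q : ℝ) ≠ 0 := by positivity
  have hpi := Real.pi_pos
  have hN : (0 : ℝ) < (w.length : ℝ) + 1 := by positivity
  ext P
  simp only [braidClosure, linkImage, Set.mem_ofPred_eq, Set.mem_iUnion, Set.mem_range]
  constructor
  · rintro ⟨j, hj, k, u, hu, rfl⟩
    -- Here `k` is a position at the start of sector j; the permutation of the preceding letters
    -- traces it back to the start of the turn.
    obtain ⟨a, i, hi⟩ := hs ((wordPerm (w.take j))⁻¹ k)
    have hjN : (j : ℝ) ≤ w.length := by exact_mod_cast hj
    have hf : (j + u) / ((w.length : ℝ) + 1) ∈ Set.Icc (0 : ℝ) 1 :=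
      ⟨div_nonneg (add_nonneg (Nat.cast_nonneg _) hu.1) hN.le,
        (div_le_one hN).2 (by linarith [hu.2])⟩
    refine ⟨a, 2 * Real.pi * (i + (j + u) / ((w.length : ℝ) + 1)) / q, ?_⟩
    rw [closedBraidCurve, mul_div_cancel₀ _ hq', mul_div_cancel_left₀ _ (by positivity),
      wordLoop_add w s a i hf, hi, mul_div_cancel₀ _ hN.ne', wordMotion_letter w _ hj hu,
      ← Equiv.Perm.mul_apply, mul_inv_cancel, Equiv.Perm.one_apply, bookPoint_add_int]
  · rintro ⟨a, θ, rfl⟩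
    rw [closedBraidCurve]
    set x := q * θ / (2 * Real.pi) with hx
    have hθ : q * θ = 2 * Real.pi * (⌊x⌋ + Int.fract x) := by
      rw [Int.floor_add_fract, hx]; field_simp
    set y := ((w.length : ℝ) + 1) * Int.fract x with hy
    have hy0 : 0 ≤ y := mul_nonneg hN.le (Int.fract_nonneg x)
    have hyN : y < w.length + 1 := by nlinarith [Int.fract_lt_one x]
    have hj : ⌊y⌋₊ ≤ w.length := by
      have : ⌊y⌋₊ < w.length + 1 := (Nat.floor_lt hy0).2 (by exact_mod_cast hyN)
      omega
    have hu : y - ⌊y⌋₊ ∈ Set.Icc (0 : ℝ) 1 :=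
      ⟨by linarith [Nat.floor_le hy0], by linarith [Nat.lt_floor_add_one y]⟩
    have hletter := wordMotion_letter w ((wordPerm w ^ ⌊x⌋) (s a)) hj hu
    rw [add_sub_cancel] at hletter
    have hZ : wordLoop w s a x = wordMotion w ((wordPerm w ^ ⌊x⌋) (s a)) y := by
      conv_lhs => rw [← Int.floor_add_fract x]
      exact wordLoop_add w s a ⌊x⌋ ⟨Int.fract_nonneg x, (Int.fract_lt_one x).le⟩
    refine ⟨⌊y⌋₊, hj, wordPerm (w.take ⌊y⌋₊) ((wordPerm w ^ ⌊x⌋) (s a)), y - ⌊y⌋₊, hu, ?_⟩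
    rw [hZ, hletter, hθ, bookPoint_add_int, add_sub_cancel, hy, mul_div_cancel_left₀ _ hN.ne']

/-- Each product is first replaced by a concatenation of two paths of equal duration. The two
concatenations then differ by a half-period shift. -/
theorem wordLoop_append_conj {m q : ℕ} (w w' : BraidWord m) {s : Fin 2 → Fin m}
    (hs : OrbitsOfLength q (wordPerm (w ++ w')) s) :
    BraidHomotopic q (wordLoop (w ++ w') s)
      (wordLoop (w' ++ w) fun a => wordPerm w (s a)) := by
  have hperm := wordPerm_append w w'
  have hsemi : SemiconjBy (wordPerm w)⁻¹ (wordPerm w * wordPerm w') (wordPerm w' * wordPerm w) := by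
    simp [SemiconjBy, mul_assoc]
  have hs₁ : OrbitsOfLength q (wordPerm w' * wordPerm w) s := hperm ▸ hs
  have hs₂ : OrbitsOfLength q (wordPerm w * wordPerm w') (fun a => wordPerm w (s a)) :=
    .of_semiconjBy hsemi (by simpa using hs₁)
  have h1 := braidHomotopic_of_pathClass_eq hs
    ((wordClass_one (w ++ w')).symm.trans (wordClass_append_one w w'))
  have hm := strandMotion_pathMotion ((wordLoopPath w).trans (wordPath w' (wordPerm w)))
  have h2 := BraidHomotopic.shift (hm.closedBraid hs₁)
    (continuous_braidLoop hm (continuous_pathMotion _) s) (1 / 2)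
  have h3 := braidHomotopic_of_pathClass_eq hs₂
    ((wordClass_append_one w' w).symm.trans (wordClass_one (w' ++ w)))
  refine h1.trans (h2.trans ?_)
  convert h3 using 1
  · funext a x
    exact braidLoop_trans_shift
      (fun k x => (pathMotion_wordPath w (wordPerm w') k x).trans
        (pathMotion_wordLoopPath w (wordPerm w' k) x).symm)
      (fun k x => (pathMotion_wordPath w' (wordPerm w) k x).trans
        (pathMotion_wordLoopPath w' (wordPerm w k) x).symm) s a x
  · rfl

theorem wordLoop_congr {m q : ℕ} {w w' : BraidWord m} (h : wordClass w = wordClass w')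
    {s : Fin 2 → Fin m} (hs : OrbitsOfLength q (wordPerm w) s) :
    BraidHomotopic q (wordLoop w s) (wordLoop w' s) :=
  braidHomotopic_of_pathClass_eq hs (by rw [← wordClass_one, ← wordClass_one, h])

theorem wordPerm_congr {m : ℕ} {w w' : BraidWord m} (h : wordClass w = wordClass w') :
    wordPerm w = wordPerm w' := by
  have h1 := congrFun h 1
  rw [wordClass_one, wordClass_one] at h1
  exact congrArg Sigma.fst h1

/-- The motion of the word and the straight-line motion are layered for the same heights. -/
theorem wordLoop_spiralWord {n : ℕ} (hn : 1 ≤ n) :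
    BraidHomotopic (n + 1) (wordLoop (spiralWord n) (spiralStart n)) (spiralBraid n) := by
  refine braidHomotopic_of_homotopic (orbitsOfLength_spiralWord hn) ?_
  exact LayeredPath.homotopic (spiralHeight_injective n)
    (fun u k l hkl hx => (wordLayered_spiralWord hn).layeredPath 1 u k l hkl hx)
    (layeredPath_linearPath _ _) (fun _ => rfl) (fun _ => rfl)

theorem mainTheorem9 (n : ℕ) (hn : 1 ≤ n) :
    IsUnlink 2 (twistedTorusLink (2 * n + 2) (2 * n) (2 * n + 1) (Nat.le_succ (2 * n + 1)) (-1)) := by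
  set ρ := wordPerm (twistPrefix n)
  -- Starting points are pulled back through the prefix, so that after conjugation the loops begin
  -- at the chosen representatives of the two cycles.
  let s : Fin 2 → Fin (2 * n + 2) := fun a => ρ⁻¹ (spiralStart n a)
  have hρs : (fun a => ρ (s a)) = spiralStart n := funext fun a => ρ.apply_symm_apply _
  have hc := wordClass_twistedTorusWord n
  have hp := wordPerm_congr hc
  have hp' := wordPerm_congr (wordClass_twistSuffix_append n)
  have hsemi : SemiconjBy ρ (wordPerm (twistPrefix n ++ twistSuffix n))
      (wordPerm (spiralWord n)) := by
    rw [← hp', wordPerm_append, wordPerm_append]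
    simp [SemiconjBy, mul_assoc, ρ]
  have hs : OrbitsOfLength (n + 1) (wordPerm (twistPrefix n ++ twistSuffix n)) s :=
    .of_semiconjBy hsemi (by rw [hρs]; exact orbitsOfLength_spiralWord hn)
  have hs' : OrbitsOfLength (n + 1) (wordPerm (twistSuffix n ++ twistPrefix n))
      (spiralStart n) := by
    rw [hp']; exact orbitsOfLength_spiralWord hn
  have hchain := (wordLoop_congr hc (hp ▸ hs)).trans (wordLoop_append_conj _ _ hs)
  rw [hρs] at hchain
  have hchain' := (hchain.trans (wordLoop_congr (wordClass_twistSuffix_append n) hs')).trans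
    ((wordLoop_spiralWord hn).trans (spiralBraid_homotopic_torusBraid hn))
  rw [twistedTorusLink, braidClosure_eq_linkImage n.succ_pos (s := s) fun k => ?_]
  · exact isUnlink_of_braidHomotopic_torusBraid n.succ_pos (contDiff_wordLoop _ s) hchain'
  · obtain ⟨a, j, h⟩ := exists_zpow_spiralStart hn (ρ k)
    refine ⟨a, j, ρ.injective ?_⟩
    rw [hp, ← Equiv.Perm.mul_apply, (hsemi.zpow_right j).eq, Equiv.Perm.mul_apply,
      ← h, ← congrFun hρs a]

end
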